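/- Let $\Sigma$ be a (possibly infinite, many-sorted) signature, let $\mathsf{U}$ be a cartesian theory in $\Sigma$, and let $\mathcal{C}=\mathrm{Mod}(\mathsf{U})$ be its category of models and homomorphisms. For a formula-in-context $\vec x.\varphi$ that is cartesian over $\mathsf U$, let $\langle \vec x\mid\varphi\rangle\in\mathcal C$ denote the model freely generated by a tuple $\vec x$ satisfying $\varphi$, so that homomorphisms $h:\langle\vec x\mid\varphi\rangle\to b$ correspond bijectively to tuples $\vec c$ of $b$ with $b\models\varphi(\vec c)$ ($h$ is *induced by* $\vec c$). Assume that $\mathcal{C}$ is wooded: it is well-powered, has an initial object, and is equipped with a stable proper factorisation system $(\mathcal Q,\mathcal M)$ (a weak factorisation system with $\mathcal Q\subseteq$ epis, $\mathcal M\subseteq$ monos, such that the pullback of an arrow of $\mathcal Q$ along an arrow of $\mathcal M$ exists and is in $\mathcal Q$). Arrows in $\mathcal M$ are called embeddings and written $\rightarrowtail$. An object $P$ is a path if the poset of embeddings into $P$, up to isomorphism over $P$, is a finite chain; $\mathbb P(X)$ is the poset of embeddings of paths into $X$, up to isomorphism over $X$, and $\prec$ denotes its covering relation. Assume that the path embeddings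 of $\mathcal C$ are definable in $\Sigma$: every path is finitely presentable in $\mathcal C$, and for each path of the form $\langle\vec y\mid\psi\rangle$ there is a formula $\chi(\vec y)$ of $\mathcal L_{\infty}(\Sigma)$ (finitary quantifiers, arbitrary small conjunctions and disjunctions) such that, for all $a\in\mathcal C$, a morphism $\langle\vec y\mid\psi\rangle\to a$ induced by $\vec c$ is an embedding if and only if $a\models\chi(\vec c)$. For $a,b\in\mathcal C$, the game $\mathcal G(a,b)$ has as positions the pairs $(m,n)\in\mathbb P(a)\times\mathbb P(b)$; from $(m,n)$ either Spoiler chooses some $m'\succ m$ and Duplicator answers with some $n'\succ n$, or Spoiler chooses some $n'\succ n$ and Duplicator answers with some $m'\succ m$. A position $(m,n)$ has rank $\geq 0$ if $\mathrm{dom}(m)\cong\mathrm{dom}(n)$; it has rank $\ge\alpha+1$ if $\mathrm{dom}(m)\cong\mathrm{dom}(n)$ and to each Spoiler move Duplicator can answer with a move to a position of rank $\ge\alpha$; and, for a limit ordinal $\alpha$, it has rank $\ge\alpha$ if it has rank $\ge\beta$ for all $\beta<\alpha$. Then one can choose: for each path $Q$, a cartesian formula $\varpi_Q(\vec z_Q)$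 and an isomorphism $Q\cong\langle\vec z_Q\mid\varpi_Q\rangle$, and a formula $\mathrm{Emb}[Q](\vec z_Q)$ defining the tuples that induce embeddings; for each embedding $\ell:Q\rightarrowtail Q'$ of paths, a cartesian formula $\vartheta_\ell(\vec z_{Q'},\vec z_Q)$ that represents the morphism from $[\vec z_{Q'}\mid\varpi_{Q'}]$ to $[\vec z_{Q}\mid\varpi_{Q}]$ in the syntactic category of $\mathsf U$ corresponding to $\ell$; and a small set of paths that represents all paths up to isomorphism. For any such choice, any $a\in\mathcal C$, any path embedding $m:P\rightarrowtail a$ and any path $Q$, define formulae $\Theta[a,m,Q,\alpha](\vec z_Q)$ of $\mathcal L_\infty(\Sigma)$ by recursion on the ordinal $\alpha$, where $\mathrm{Iso}[P,Q]$ is $\top$ if $P\cong Q$ and $\bot$ otherwise, $m'$ ranges over the $m'\in\mathbb P(a)$ with $m\prec m'$, and $\ell:Q\rightarrowtail Q'$ ranges over the embeddings into the chosen representatives $Q'$ of paths such that $\ell\prec\mathrm{id}_{Q'}$ in $\mathbb P(Q')$: - $\Theta[a,m,Q,0]=\mathrm{Iso}[P,Q]$, and $\Theta[a,m,Q,\alpha]=\bigwedge_{\beta<\alpha}\Theta[a,m,Q,\beta]$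 for $\alpha$ a limit ordinal; - $\Theta[a,m,Q,\alpha+1]$ is the conjunction of $\mathrm{Iso}[P,Q]$, of $$\bigwedge_{m'}\bigvee_{\ell}(\exists\vec z')\big(\varpi_{Q'}(\vec z')\wedge\vartheta_\ell(\vec z',\vec z_Q)\wedge\mathrm{Emb}[Q'](\vec z')\wedge\Theta[a,m',Q',\alpha](\vec z')\big),$$ and of $$\bigwedge_{\ell}(\forall\vec z')\Big(\big(\varpi_{Q'}(\vec z')\wedge\vartheta_\ell(\vec z',\vec z_Q)\wedge\mathrm{Emb}[Q'](\vec z')\big)\to\bigvee_{m'}\Theta[a,m',Q',\alpha](\vec z')\Big).$$ Then for all $a,b\in\mathcal C$, all path embeddings $m:P\rightarrowtail a$, all path embeddings $n:Q\rightarrowtail b$ induced by a tuple $\vec c$ of $b$ with $b\models\varpi_Q(\vec c)$, and all ordinals $\alpha$, $$b\models\Theta[a,m,Q,\alpha](\vec c)\quad\Longleftrightarrow\quad (m,n)\text{ is a position of rank}\ge\alpha\text{ in }\mathcal G(a,b).$$ -/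

import Mathlib

open CategoryTheory Limits

universe u w

/-! ## Many-sorted signatures, structures, homomorphisms -/

/-- A (possibly infinite) many-sorted first-order signature. -/
structure Signature where
  Sorts : Type u
  /-- function symbols, with their list of argument sorts and their value sort -/
  Fun : List Sorts → Sorts → Type u
  /-- relation symbols, with their list of argument sorts -/
  Rel : List Sorts → Type u

/-- `Var Γ s` is the type of the variables of sort `s` declared in the context `Γ`. A context is a
finite list of sorts: variables have no names, so that formulae are given up to renaming. -/
inductive Var {S : Type u} : List S → S → Type u
  | zero {Γ : List S} {s : S} : Var (s :: Γ) s
  | succ {Γ : List S} {s t : S} : Var Γ s → Var (t :: Γ) s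

/-- Tuples of elements of a sorted family, of the same sorts as the context `Γ`. -/
abbrev Tuple {S : Type u} (A : S → Type w) (Γ : List S) : Type (max u w) :=
  ∀ ⦃s : S⦄, Var Γ s → A s

namespace Tuple

variable {S : Type u} {A : S → Type w}

/-- The empty tuple. -/
def nil : Tuple A [] := fun _ i => nomatch i

/-- The tuple `x, v`. -/
def cons {Γ : List S} {s : S} (x : A s) (v : Tuple A Γ) : Tuple A (s :: Γ)
  | _, .zero => x
  | _, .succ i => v i

/-- The concatenation `v, v'` of two tuples. -/
def append : ∀ {Γ Δ : List S}, Tuple A Γ → Tuple A Δ → Tuple A (Γ ++ Δ)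
  | [], _, _, v' => v'
  | _ :: _, _, v, v' => cons (v .zero) (append (fun _ i => v (.succ i)) v')

end Tuple

namespace Var

variable {S : Type u}

/-- The variables of `Γ`, seen in the context `Γ, Δ`. -/
def left : ∀ {Γ : List S} (Δ : List S), Tuple (Var (Γ ++ Δ)) Γ
  | _ :: _, _, _, .zero => .zero
  | _ :: _, Δ, _, .succ i => .succ (left Δ i)

/-- The variables of `Δ`, seen in the context `Γ, Δ`. -/
def right : ∀ (Γ : List S) {Δ : List S}, Tuple (Var (Γ ++ Δ)) Δ
  | [], _, _, i => i
  | _ :: Γ, _, _, i => .succ (right Γ i)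

/-- A renaming of variables, extended by a fresh variable. -/
def lift {Γ Δ : List S} {s : S} (ρ : Tuple (Var Δ) Γ) : Tuple (Var (s :: Δ)) (s :: Γ) :=
  Tuple.cons .zero (fun _ i => .succ (ρ i))

end Var

/-- Structures for the signature `σ`. -/
structure Str (σ : Signature.{u}) where
  carrier : σ.Sorts → Type u
  funMap : ∀ {Γ : List σ.Sorts} {s : σ.Sorts}, σ.Fun Γ s → Tuple carrier Γ → carrier s
  RelMap : ∀ {Γ : List σ.Sorts}, σ.Rel Γ → Tuple carrier Γ → Prop

namespace Str

variable {σ : Signature.{u}}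

/-- Homomorphisms of `σ`-structures. -/
@[ext]
structure Hom (M N : Str σ) where
  toFun : ∀ s : σ.Sorts, M.carrier s → N.carrier s
  map_fun : ∀ {Γ : List σ.Sorts} {s : σ.Sorts} (f : σ.Fun Γ s) (v : Tuple M.carrier Γ),
    toFun s (M.funMap f v) = N.funMap f (fun t i => toFun t (v i))
  map_rel : ∀ {Γ : List σ.Sorts} (R : σ.Rel Γ) (v : Tuple M.carrier Γ),
    M.RelMap R v → N.RelMap R (fun t i => toFun t (v i))

/-- The category of `σ`-structures and homomorphisms. -/
instance : Category (Str σ) where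
  Hom := Hom
  id M := ⟨fun _ x => x, fun _ _ => rfl, fun _ _ h => h⟩
  comp f g :=
    { toFun := fun s x => g.toFun s (f.toFun s x)
      map_fun := fun F v => by rw [f.map_fun, g.map_fun]
      map_rel := fun R v h => g.map_rel R _ (f.map_rel R v h) }

end Str

/-! ## Terms and formulae in context -/

/-- Terms-in-context. -/
inductive Term (σ : Signature.{u}) (Γ : List σ.Sorts) : σ.Sorts → Type u
  | var {s : σ.Sorts} (i : Var Γ s) : Term σ Γ s
  | app {ar : List σ.Sorts} {s : σ.Sorts} (f : σ.Fun ar s)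
      (ts : ∀ ⦃t : σ.Sorts⦄, Var ar t → Term σ Γ t) : Term σ Γ s

namespace Term

variable {σ : Signature.{u}}

/-- Renaming of variables. -/
def rename {Γ Δ : List σ.Sorts} (ρ : Tuple (Var Δ) Γ) : ∀ {s : σ.Sorts}, Term σ Γ s → Term σ Δ s
  | _, .var i => .var (ρ i)
  | _, .app f ts => .app f (fun _ i => (ts i).rename ρ)

/-- The value of a term in a structure. -/
def eval (M : Str σ) {Γ : List σ.Sorts} (v : Tuple M.carrier Γ) :
    ∀ {s : σ.Sorts}, Term σ Γ s → M.carrier s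
  | _, .var i => v i
  | _, .app f ts => M.funMap f (fun _ i => (ts i).eval M v)

end Term

/-- Formulae-in-context of the infinitary language `L_∞(σ) = L_{∞,ω}(σ)`: conjunctions and
disjunctions are indexed by arbitrary small sets. -/
inductive Formula (σ : Signature.{u}) : List σ.Sorts → Type (u + 1)
  | eq {Γ : List σ.Sorts} {s : σ.Sorts} (t t' : Term σ Γ s) : Formula σ Γ
  | rel {Γ ar : List σ.Sorts} (R : σ.Rel ar) (ts : ∀ ⦃t : σ.Sorts⦄, Var ar t → Term σ Γ t) :
      Formula σ Γ
  | not {Γ : List σ.Sorts} (φ : Formula σ Γ) : Formula σ Γ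
  | all {Γ : List σ.Sorts} {s : σ.Sorts} (φ : Formula σ (s :: Γ)) : Formula σ Γ
  | ex {Γ : List σ.Sorts} {s : σ.Sorts} (φ : Formula σ (s :: Γ)) : Formula σ Γ
  | conj {Γ : List σ.Sorts} {I : Type u} (φ : I → Formula σ Γ) : Formula σ Γ
  | disj {Γ : List σ.Sorts} {I : Type u} (φ : I → Formula σ Γ) : Formula σ Γ

namespace Formula

variable {σ : Signature.{u}}

/-- `φ.Realize M v` means `M ⊨ φ(v)`. -/
def Realize (M : Str σ) : ∀ {Γ : List σ.Sorts}, Formula σ Γ → Tuple M.carrier Γ → Prop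
  | _, .eq t t', v => t.eval M v = t'.eval M v
  | _, .rel R ts, v => M.RelMap R (fun _ i => (ts i).eval M v)
  | _, .not φ, v => ¬ φ.Realize M v
  | _, .all φ, v => ∀ x, φ.Realize M (Tuple.cons x v)
  | _, .ex φ, v => ∃ x, φ.Realize M (Tuple.cons x v)
  | _, .conj φ, v => ∀ i, (φ i).Realize M v
  | _, .disj φ, v => ∃ i, (φ i).Realize M v

/-- Renaming of (free) variables. -/
def rename : ∀ {Γ Δ : List σ.Sorts}, Tuple (Var Δ) Γ → Formula σ Γ → Formula σ Δ
  | _, _, ρ, .eq t t' => .eq (t.rename ρ) (t'.rename ρ)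
  | _, _, ρ, .rel R ts => .rel R (fun _ i => (ts i).rename ρ)
  | _, _, ρ, .not φ => .not (φ.rename ρ)
  | _, _, ρ, .all φ => .all (φ.rename (Var.lift ρ))
  | _, _, ρ, .ex φ => .ex (φ.rename (Var.lift ρ))
  | _, _, ρ, .conj φ => .conj (fun i => (φ i).rename ρ)
  | _, _, ρ, .disj φ => .disj (fun i => (φ i).rename ρ)

/-- Conjunction over an index type that is small up to bijection. -/
noncomputable def bigAnd {Γ : List σ.Sorts} {I : Type w} [Small.{u} I] (φ : I → Formula σ Γ) :
    Formula σ Γ :=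
  .conj fun i : Shrink.{u} I => φ ((equivShrink I).symm i)

/-- Disjunction over an index type that is small up to bijection. -/
noncomputable def bigOr {Γ : List σ.Sorts} {I : Type w} [Small.{u} I] (φ : I → Formula σ Γ) :
    Formula σ Γ :=
  .disj fun i : Shrink.{u} I => φ ((equivShrink I).symm i)

/-- `True`, the empty conjunction. -/
def top {Γ : List σ.Sorts} : Formula σ Γ := .conj (I := PEmpty) (fun i => nomatch i)

/-- `False`, the empty disjunction. -/
def bot {Γ : List σ.Sorts} : Formula σ Γ := .disj (I := PEmpty) (fun i => nomatch i)

/-- Binary conjunction. -/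
def and {Γ : List σ.Sorts} (φ ψ : Formula σ Γ) : Formula σ Γ :=
  .conj fun i : ULift.{u} Bool => cond i.down φ ψ

/-- Binary disjunction. -/
def or {Γ : List σ.Sorts} (φ ψ : Formula σ Γ) : Formula σ Γ :=
  .disj fun i : ULift.{u} Bool => cond i.down φ ψ

/-- Implication. -/
def imp {Γ : List σ.Sorts} (φ ψ : Formula σ Γ) : Formula σ Γ := or (.not φ) ψ

/-- `(∃ z') φ(z', z)` for a block of variables `z'`. -/
def exs : ∀ (Δ : List σ.Sorts) {Γ : List σ.Sorts}, Formula σ (Δ ++ Γ) → Formula σ Γ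
  | [], _, φ => φ
  | _ :: Δ, _, φ => exs Δ (.ex φ)

/-- `(∀ z') φ(z', z)` for a block of variables `z'`. -/
def alls : ∀ (Δ : List σ.Sorts) {Γ : List σ.Sorts}, Formula σ (Δ ++ Γ) → Formula σ Γ
  | [], _, φ => φ
  | _ :: Δ, _, φ => alls Δ (.all φ)

end Formula

/-! ## Cartesian theories and their models -/

/-- Regular formulae-in-context: built from atomic formulae with finite conjunctions and
existential quantifiers. -/
inductive RegFormula (σ : Signature.{u}) : List σ.Sorts → Type u
  | eq {Γ : List σ.Sorts} {s : σ.Sorts} (t t' : Term σ Γ s) : RegFormula σ Γ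
  | rel {Γ ar : List σ.Sorts} (R : σ.Rel ar) (ts : ∀ ⦃t : σ.Sorts⦄, Var ar t → Term σ Γ t) :
      RegFormula σ Γ
  | top {Γ : List σ.Sorts} : RegFormula σ Γ
  | and {Γ : List σ.Sorts} (φ ψ : RegFormula σ Γ) : RegFormula σ Γ
  | ex {Γ : List σ.Sorts} {s : σ.Sorts} (φ : RegFormula σ (s :: Γ)) : RegFormula σ Γ

/-- A regular formula as a formula of `L_∞`. -/
def RegFormula.toFormula {σ : Signature.{u}} :
    ∀ {Γ : List σ.Sorts}, RegFormula σ Γ → Formula σ Γ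
  | _, .eq t t' => .eq t t'
  | _, .rel R ts => .rel R ts
  | _, .top => .top
  | _, .and φ ψ => .and φ.toFormula ψ.toFormula
  | _, .ex φ => .ex φ.toFormula

/-- `M ⊨ φ(v)` for a regular formula. -/
def RegFormula.Realize {σ : Signature.{u}} {Γ : List σ.Sorts} (φ : RegFormula σ Γ) (M : Str σ)
    (v : Tuple M.carrier Γ) : Prop :=
  φ.toFormula.Realize M v

/-- A sequent `φ ⊢_Γ ψ` between regular formulae. -/
structure RegSequent (σ : Signature.{u}) where
  ctx : List σ.Sorts
  lhs : RegFormula σ ctx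
  rhs : RegFormula σ ctx

/-- A regular theory is a set of regular sequents. -/
abbrev RegTheory (σ : Signature.{u}) := Set (RegSequent σ)

/-- `M` is a model of the theory `T`. -/
def RegTheory.IsModel {σ : Signature.{u}} (T : RegTheory σ) (M : Str σ) : Prop :=
  ∀ τ ∈ T, ∀ v : Tuple M.carrier τ.ctx, τ.lhs.Realize M v → τ.rhs.Realize M v

/-- `φ` is cartesian over `T`: all its existential quantifiers are `T`-provably unique, that is,
`T` proves `φ ∧ φ[x'/x] ⊢ x = x'` whenever `(∃ x) φ` is a subformula. Here and below, `T` proves a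
sequent if it is valid in all models of `T`; by completeness of regular logic for set-based models,
the same sequents are derivable from `T` in the usual sequent calculus. -/
def RegFormula.IsCartesian {σ : Signature.{u}} (T : RegTheory σ) :
    ∀ {Γ : List σ.Sorts}, RegFormula σ Γ → Prop
  | _, .eq _ _ => True
  | _, .rel _ _ => True
  | _, .top => True
  | _, .and φ ψ => φ.IsCartesian T ∧ ψ.IsCartesian T
  | _, .ex φ => φ.IsCartesian T ∧
      ∀ M : Str σ, T.IsModel M → ∀ v x x',
        φ.Realize M (Tuple.cons x v) → φ.Realize M (Tuple.cons x' v) → x = x'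

/-- A regular theory is cartesian if there is a well-founded (strict) partial order on its axioms
such that each axiom is cartesian over the theory formed by the axioms that precede it. -/
def RegTheory.IsCartesian {σ : Signature.{u}} (T : RegTheory σ) : Prop :=
  ∃ r : T → T → Prop, (∀ x y z, r x y → r y z → r x z) ∧ WellFounded r ∧
    ∀ τ : T,
      τ.1.lhs.IsCartesian {τ' | ∃ h : τ' ∈ T, r ⟨τ', h⟩ τ} ∧
      τ.1.rhs.IsCartesian {τ' | ∃ h : τ' ∈ T, r ⟨τ', h⟩ τ}

/-- The category `Mod(T)` of models of `T` and all homomorphisms between them. -/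
abbrev ModCat {σ : Signature.{u}} (T : RegTheory σ) :=
  ObjectProperty.FullSubcategory (fun M : Str σ => T.IsModel M)

namespace ModCat

variable {σ : Signature.{u}} {T : RegTheory σ}

/-- Tuples of elements of a model. -/
abbrev Tup (a : ModCat T) (Γ : List σ.Sorts) := Tuple a.obj.carrier Γ

/-- The image of a tuple under a homomorphism. -/
def mapTup {a b : ModCat T} (h : a ⟶ b) {Γ : List σ.Sorts} (v : a.Tup Γ) : b.Tup Γ :=
  fun s i => h.hom.toFun s (v i)

/-- `a` is the finitely presented model `⟨Γ ∣ φ⟩`, with the generators `g`: the homomorphisms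
`h : a ⟶ b` correspond bijectively to the tuples `c ∈ ⟦Γ ∣ φ⟧_b`, by `c = h(g)`. In other words,
`a` (co)represents the functor `⟦Γ ∣ φ⟧` on models, with universal element `g`. -/
structure IsPresentedBy (a : ModCat T) {Γ : List σ.Sorts} (φ : RegFormula σ Γ) (g : a.Tup Γ) :
    Prop where
  realize : φ.Realize a.obj g
  existsUnique : ∀ (b : ModCat T) (c : b.Tup Γ), φ.Realize b.obj c → ∃! h : a ⟶ b, mapTup h g = c

end ModCat

/-- `θ(x, y)` is a `T`-provably functional relation from `[Γ ∣ φ]` to `[Δ ∣ ψ]`; such relations,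
up to `T`-provable equivalence, are the morphisms of the syntactic category of `T`. -/
structure IsFunctionalRel {σ : Signature.{u}} (T : RegTheory σ) {Γ Δ : List σ.Sorts}
    (φ : RegFormula σ Γ) (ψ : RegFormula σ Δ) (θ : RegFormula σ (Γ ++ Δ)) : Prop where
  cartesian : θ.IsCartesian T
  sub : ∀ M : Str σ, T.IsModel M → ∀ (x : Tuple M.carrier Γ) (y : Tuple M.carrier Δ),
    θ.Realize M (x.append y) → φ.Realize M x ∧ ψ.Realize M y
  unique : ∀ M : Str σ, T.IsModel M → ∀ (x : Tuple M.carrier Γ) (y y' : Tuple M.carrier Δ),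
    θ.Realize M (x.append y) → θ.Realize M (x.append y') → y' = y
  total : ∀ M : Str σ, T.IsModel M → ∀ x : Tuple M.carrier Γ,
    φ.Realize M x → ∃ y : Tuple M.carrier Δ, θ.Realize M (x.append y)

/-! ## Wooded categories, paths, games -/

section Wooded

variable {C : Type w} [Category.{u} C]

/-- `(Q, M)` is a stable (proper) factorisation system. -/
structure IsStableFactorisationSystem (Q M : MorphismProperty C) : Prop where
  wfs : MorphismProperty.IsWeakFactorizationSystem Q M
  epi : ∀ {x y : C} (f : x ⟶ y), Q f → Epi f
  mono : ∀ {x y : C} (f : x ⟶ y), M f → Mono f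
  /-- the pullback of a quotient along an embedding exists and is a quotient -/
  stable : ∀ {x y z : C} (e : x ⟶ z) (m : y ⟶ z), Q e → M m →
    ∃ (p : C) (m' : p ⟶ x) (e' : p ⟶ y), IsPullback m' e' e m ∧ Q e'

/-- `C`, equipped with the quotients `Q` and the embeddings `M`, is a wooded category. (`C` is
locally small since its hom-types are small.) -/
structure IsWooded (Q M : MorphismProperty C) : Prop where
  wellPowered : WellPowered.{u} C
  hasInitial : HasInitial C
  stable : IsStableFactorisationSystem Q M

/-- The poset of the embeddings into `X`, up to isomorphism over `X`. -/
abbrev Emb (M : MorphismProperty C) (X : C) := {S : Subobject X // M S.arrow}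

/-- `P` is a path: the poset of embeddings into `P` is a finite chain. -/
def IsPath (M : MorphismProperty C) (P : C) : Prop :=
  Finite (Emb M P) ∧ ∀ S S' : Emb M P, S ≤ S' ∨ S' ≤ S

/-- The poset of the path embeddings into `X`, up to isomorphism over `X`. -/
abbrev PathEmb (M : MorphismProperty C) (X : C) :=
  {S : Subobject X // M S.arrow ∧ IsPath M (S : C)}

/-- The domain of (a representative of) a path embedding. -/
noncomputable abbrev PathEmb.dom {M : MorphismProperty C} {X : C} (m : PathEmb M X) : C :=
  (m.1 : C)

/-- Isomorphisms transport being a path. -/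
theorem IsPath.of_iso {Q M : MorphismProperty C} (hW : IsStableFactorisationSystem Q M)
    {P P' : C} (e : P ≅ P') (hP : IsPath M P) : IsPath M P' := by
  have := hW.wfs
  have hM : M = Q.rlp := this.rlp.symm
  have key : ∀ {A B : C} (e : A ≅ B) (S : Subobject A), M S.arrow →
      M ((Subobject.map e.hom).obj S).arrow := by
    intro A B e S hS
    have h1 : M (S.arrow ≫ e.hom) := by
      subst hM
      exact (MorphismProperty.cancel_right_of_respectsIso _ _ _).2 hS
    have h2 : (Subobject.map e.hom).obj S = Subobject.mk (S.arrow ≫ e.hom) := by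
      conv_lhs => rw [← Subobject.mk_arrow S]
      rw [Subobject.map_mk]
    rw [h2]
    have h3 := Subobject.underlyingIso_hom_comp_eq_mk (S.arrow ≫ e.hom)
    rw [← h3]
    subst hM
    exact (MorphismProperty.cancel_left_of_respectsIso _ _ _).2 h1
  let F : Emb M P ≃o Emb M P' :=
    { toFun := fun S => ⟨(Subobject.map e.hom).obj S.1, key e _ S.2⟩
      invFun := fun S => ⟨(Subobject.map e.inv).obj S.1, key e.symm _ S.2⟩
      left_inv := fun S => Subtype.ext (by
        change (Subobject.map e.inv).obj ((Subobject.map e.hom).obj S.1) = S.1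
        rw [← Subobject.map_comp]; simp [Subobject.map_id])
      right_inv := fun S => Subtype.ext (by
        change (Subobject.map e.hom).obj ((Subobject.map e.inv).obj S.1) = S.1
        rw [← Subobject.map_comp]; simp [Subobject.map_id])
      map_rel_iff' := by
        intro S S'
        constructor
        · intro h
          have h' := (Subobject.map e.inv).monotone (show
            (Subobject.map e.hom).obj S.1 ≤ (Subobject.map e.hom).obj S'.1 from h)
          rw [← Subobject.map_comp, ← Subobject.map_comp] at h'
          simpa [Subobject.map_id] using h'
        · intro h
          exact (Subobject.map e.hom).monotone h }
  refine ⟨?_, fun S S' => ?_⟩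
  · have := hP.1
    exact Finite.of_equiv _ F.toEquiv
  · rcases hP.2 (F.symm S) (F.symm S') with h | h
    · exact Or.inl (F.symm.le_iff_le.1 h)
    · exact Or.inr (F.symm.le_iff_le.1 h)

/-- The element of the poset of path embeddings into `X` given by an embedding `m : P ⟶ X` of a
path `P`. -/
noncomputable def PathEmb.mk {Q M : MorphismProperty C} (hW : IsStableFactorisationSystem Q M)
    {P X : C} (m : P ⟶ X) (hm : M m) (hP : IsPath M P) : PathEmb M X :=
  haveI := hW.mono m hm
  ⟨Subobject.mk m, by
    have hM : M = Q.rlp := hW.wfs.rlp.symm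
    rw [← Subobject.underlyingIso_hom_comp_eq_mk m]
    subst hM
    exact (MorphismProperty.cancel_left_of_respectsIso _ _ _).2 hm,
    hP.of_iso hW (Subobject.underlyingIso m).symm⟩

/-- The winning relation of the game `G(a, b)`, whose positions are pairs of path embeddings. -/
def winning (M : MorphismProperty C) (a b : C) : Set (PathEmb M a × PathEmb M b) :=
  {p | Nonempty (p.1.dom ≅ p.2.dom)}

/-- `posRank M a b α` is the set of the positions of rank `≥ α` in the game `G(a, b)`. In a round
from position `(m, n)`, either Spoiler chooses some `m'` covering `m` and Duplicator responds with
some `n'` covering `n`, or Spoiler chooses some `n'` covering `n` and Duplicator responds with some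
`m'` covering `m`. -/
noncomputable def posRank (M : MorphismProperty C) (a b : C) (α : Ordinal.{u}) :
    Set (PathEmb M a × PathEmb M b) :=
  Ordinal.limitRecOn α
    (winning M a b)
    (fun _ R => {p | p ∈ winning M a b ∧
      (∀ m', p.1 ⋖ m' → ∃ n', p.2 ⋖ n' ∧ (m', n') ∈ R) ∧
      (∀ n', p.2 ⋖ n' → ∃ m', p.1 ⋖ m' ∧ (m', n') ∈ R)})
    (fun _ _ R => {p | ∀ β hβ, p ∈ R β hβ})

end Wooded

/-! ## Definable path embeddings and Hintikka formulae -/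

section Hintikka

variable {σ : Signature.{u}} {T : RegTheory σ}

/-- The path embeddings of `Mod(T)` (with the embeddings `M`) are definable in the signature `σ`
of the cartesian theory `T`. -/
structure DefinablePathEmbeddings (T : RegTheory σ) (M : MorphismProperty (ModCat T)) : Prop where
  cartesian : T.IsCartesian
  path_fp : ∀ P : ModCat T, IsPath M P → IsFinitelyPresentable.{u} P
  /-- for each path `P = ⟨Γ ∣ ψ⟩`, some formula defines the tuples that induce an embedding -/
  formula : ∀ (P : ModCat T), IsPath M P → ∀ {Γ : List σ.Sorts} (ψ : RegFormula σ Γ) (g : P.Tup Γ),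
    ψ.IsCartesian T → P.IsPresentedBy ψ g →
    ∃ χ : Formula σ Γ, ∀ (a : ModCat T) (h : P ⟶ a) (c : a.Tup Γ), ModCat.mapTup h g = c →
      (M h ↔ χ.Realize a.obj c)

/-- The paths of `Mod(T)`. -/
abbrev PathObj {T : RegTheory σ} (M : MorphismProperty (ModCat T)) := {P : ModCat T // IsPath M P}

/-- The choices that the construction of Hintikka formulae depends on. -/
structure HintikkaChoice (T : RegTheory σ) (M : MorphismProperty (ModCat T)) where
  /-- the context `z_Q` -/
  ctx : PathObj M → List σ.Sorts
  /-- the cartesian formula `ϖ_Q(z_Q)` such that `Q ≅ ⟨z_Q ∣ ϖ_Q⟩` -/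
  pres : ∀ P : PathObj M, RegFormula σ (ctx P)
  pres_cartesian : ∀ P : PathObj M, (pres P).IsCartesian T
  /-- the tuple of generators of `Q`, which fixes the isomorphism `Q ≅ ⟨z_Q ∣ ϖ_Q⟩` -/
  gen : ∀ P : PathObj M, P.1.Tup (ctx P)
  presented : ∀ P : PathObj M, P.1.IsPresentedBy (pres P) (gen P)
  /-- the formula `Emb[Q](z_Q)` -/
  emb : ∀ P : PathObj M, Formula σ (ctx P)
  emb_iff : ∀ (P : PathObj M) (a : ModCat T) (h : P.1 ⟶ a) (c : a.Tup (ctx P)),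
    ModCat.mapTup h (gen P) = c → (M h ↔ (emb P).Realize a.obj c)
  /-- for an embedding `ℓ : Q ⟶ Q'`, a formula `ϑ_ℓ(z', z)` that represents the morphism
  `[z' ∣ ϖ_{Q'}] → [z ∣ ϖ_Q]` of the syntactic category which corresponds to `ℓ` -/
  graph : ∀ {P P' : PathObj M} (l : P.1 ⟶ P'.1), M l → RegFormula σ (ctx P' ++ ctx P)
  graph_functional : ∀ {P P' : PathObj M} (l : P.1 ⟶ P'.1) (hl : M l),
    IsFunctionalRel T (pres P') (pres P) (graph l hl)
  /-- under the Yoneda embedding, `ϑ_ℓ` corresponds to `ℓ` -/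
  graph_yoneda : ∀ {P P' : PathObj M} (l : P.1 ⟶ P'.1) (hl : M l),
    (graph l hl).Realize P'.1.obj (Tuple.append (gen P') (ModCat.mapTup l (gen P)))
  /-- a small set of paths that represents all paths up to isomorphism -/
  Idx : Type u
  rep : Idx → PathObj M
  rep_surj : ∀ P : PathObj M, ∃ i, Nonempty (P.1 ≅ (rep i).1)

namespace HintikkaChoice

variable {M : MorphismProperty (ModCat T)}

/-- The (small) set of the embeddings `ℓ : P ⟶ P'` such that `P'` is one of the chosen
representatives of paths and `ℓ ≺ id_{P'}`, that is, `id_{P'}` covers `ℓ`. -/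
def Step {Q : MorphismProperty (ModCat T)} (H : HintikkaChoice T M)
    (hW : IsStableFactorisationSystem Q M) (P : PathObj M) (i : H.Idx) : Type u :=
  {l : P.1 ⟶ (H.rep i).1 // ∃ (hl : M l) (hid : M (𝟙 (H.rep i).1)),
    PathEmb.mk hW l hl P.2 ⋖ PathEmb.mk hW (𝟙 (H.rep i).1) hid (H.rep i).2}

/-- `ϖ_{P'}(z') ∧ ϑ_ℓ(z', z) ∧ Emb[P'](z')` -/
def stepFormula {Q : MorphismProperty (ModCat T)} (H : HintikkaChoice T M)
    (hW : IsStableFactorisationSystem Q M) (P : PathObj M) (i : H.Idx) (l : H.Step hW P i) :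
    Formula σ (H.ctx (H.rep i) ++ H.ctx P) :=
  Formula.and ((H.pres (H.rep i)).toFormula.rename (Var.left _))
    (Formula.and (H.graph l.1 l.2.choose).toFormula
      ((H.emb (H.rep i)).rename (Var.left _)))

open Classical in
/-- The formula `Iso[P, P']`. -/
noncomputable def iso {Γ : List σ.Sorts} (P P' : ModCat T) : Formula σ Γ :=
  if Nonempty (P ≅ P') then .top else .bot

section

variable {Q : MorphismProperty (ModCat T)} (H : HintikkaChoice T M) (hW : IsWooded Q M) (a : ModCat T)

/-- The formula `Forth[m, P, α + 1](z)`, given the formulae `Θ[-, -, α]`. -/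
noncomputable def forth (Θ : PathEmb M a → ∀ P : PathObj M, Formula σ (H.ctx P))
    (m : PathEmb M a) (P : PathObj M) : Formula σ (H.ctx P) :=
  haveI := hW.wellPowered
  Formula.bigAnd fun m' : {m' : PathEmb M a // m ⋖ m'} =>
    Formula.disj fun l : (Σ i : H.Idx, H.Step hW.stable P i) =>
      Formula.exs (H.ctx (H.rep l.1))
        (Formula.and (H.stepFormula hW.stable P l.1 l.2)
          ((Θ m'.1 (H.rep l.1)).rename (Var.left _)))

/-- The formula `Back[m, P, α + 1](z)`, given the formulae `Θ[-, -, α]`. -/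
noncomputable def back (Θ : PathEmb M a → ∀ P : PathObj M, Formula σ (H.ctx P))
    (m : PathEmb M a) (P : PathObj M) : Formula σ (H.ctx P) :=
  haveI := hW.wellPowered
  Formula.conj fun l : (Σ i : H.Idx, H.Step hW.stable P i) =>
    Formula.alls (H.ctx (H.rep l.1))
      (Formula.imp (H.stepFormula hW.stable P l.1 l.2)
        (Formula.bigOr fun m' : {m' : PathEmb M a // m ⋖ m'} =>
          (Θ m'.1 (H.rep l.1)).rename (Var.left _)))

/-- The Hintikka formulae `Θ[a, m, P, α](z_P)`. -/
noncomputable def hintikka (α : Ordinal.{u}) :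
    PathEmb M a → ∀ P : PathObj M, Formula σ (H.ctx P) :=
  Ordinal.limitRecOn α
    (fun m P => iso m.dom P.1)
    (fun _ Θ m P => Formula.and (iso m.dom P.1)
      (Formula.and (H.forth hW a Θ m P) (H.back hW a Θ m P)))
    (fun o _ Θ m P => Formula.bigAnd fun β : Set.Iio o => Θ β.1 β.2 m P)

end

end HintikkaChoice

end Hintikka

/-! ## Tuples and blocks of variables -/

namespace Tuple

variable {S : Type u} {A B : S → Type w}

/-! The equivalence is an induction on `α`, once tuples and path embeddings are interchangeable.
Over the tuple inducing `n : R ⟶ b`, a tuple satisfying the step formula of `ℓ : R ⟶ R'` is the same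
thing as an embedding `n' : R' ⟶ b` with `ℓ ≫ n' = n` (`realize_stepFormula_iff`): the presentation
yields `n'`, `Emb` makes it an embedding, and `ϑ_ℓ`, true of the generators of `R'`, is preserved by
`n'`, so that functionality forces `ℓ ≫ n'` and `n` to agree on generators. On the other side,
composition with an embedding `n'` identifies the path embeddings into `R'` with those into `b`
below `n'`; hence the covers of `n` are exactly its extensions along embeddings covered by the
identity (`PathEmb.mk_comp_covBy_iff`, `covBy_iff`). Quantifying over `ℓ` and `z'` is therefore
quantifying over the moves in `b`, and the successor clause of the formula spells out the successor
clause of the rank.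

Most of the work goes into the existence of the choices, that is, into showing that a finitely
presentable model is presented by a cartesian formula (`exists_isPresentedBy`). The model `⟨x ∣ φ⟩`
is built from the cartesian formulae defining functions of the tuples satisfying `φ`, two of them
being identified when they agree at all models with such a tuple. This stays small, as formulae form
a small type. A cartesian formula holds in this structure iff it holds at every such pointed model
(`presStr_realize_iff`), so the structure is a model and the projections generate it freely. Every
model is a filtered colimit of models of this kind; a finitely presentable one is then a retract of
some `⟨x ∣ φ⟩`, and is presented by `φ` together with the equations stating that `x` is fixed by the
idempotent.

Elements of a presented model are definable from its generators. This supplies the formulae `ϑ_ℓ`,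
and it also makes the diagram of presented models filtered. -/

@[simp] theorem cons_zero {Γ : List S} {s : S} (x : A s) (v : Tuple A Γ) :
    cons x v .zero = x := rfl

@[simp] theorem cons_succ {Γ : List S} {s : S} (x : A s) (v : Tuple A Γ) {t : S} (i : Var Γ t) :
    cons x v (.succ i : Var (s :: Γ) t) = v i := rfl

theorem map_cons (f : ∀ s, A s → B s) {Γ : List S} {s : S} (x : A s) (v : Tuple A Γ) :
    (fun t (i : Var (s :: Γ) t) => f t ((cons x v : Tuple A (s :: Γ)) i)) = cons (f s x) (fun t i => f t (v i)) := by
  funext t i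
  cases i <;> rfl

theorem cons_inj {Γ : List S} {s : S} {x x' : A s} {v v' : Tuple A Γ}
    (h : (cons x v : Tuple A (s :: Γ)) = cons x' v') : x = x' ∧ v = v' :=
  ⟨congrFun (congrFun h s) .zero, by funext t i; exact congrFun (congrFun h t) (.succ i)⟩

theorem cons_comp_lift {Γ Δ : List S} {s : S} (ρ : Tuple (Var Δ) Γ) (x : A s) (v : Tuple A Δ) :
    (fun _ i => (cons x v : Tuple A (s :: Δ)) (Var.lift ρ i)) =
      (cons x (fun _ i => v (ρ i)) : Tuple A (s :: Γ)) := by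
  funext t i
  cases i <;> rfl

@[simp] theorem append_left : ∀ {Γ Δ : List S} (v : Tuple A Γ) (w : Tuple A Δ) {s : S}
    (i : Var Γ s), (append v w) (Var.left Δ i) = v i
  | _ :: _, _, _, _, _, .zero => rfl
  | _ :: _, _, v, w, _, .succ i => append_left (fun _ i => v (.succ i)) w i

@[simp] theorem append_right : ∀ {Γ Δ : List S} (v : Tuple A Γ) (w : Tuple A Δ) {s : S}
    (i : Var Δ s), (append v w) (Var.right Γ i) = w i
  | [], _, _, _, _, _ => rfl
  | _ :: _, _, v, w, _, i => append_right (fun _ i => v (.succ i)) w i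

theorem map_append (f : ∀ s, A s → B s) : ∀ {Γ Δ : List S} (v : Tuple A Γ) (w : Tuple A Δ),
    (fun t (i : Var (Γ ++ Δ) t) => f t (append v w i)) =
      append (fun t i => f t (v i)) (fun t i => f t (w i))
  | [], _, _, _ => rfl
  | _ :: _, _, v, w => by
    funext t i
    cases i with
    | zero => rfl
    | succ i =>
      exact congrFun (congrFun (map_append f (fun _ i => v (.succ i)) w) t) i

theorem cons_eta {Γ : List S} {s : S} (v : Tuple A (s :: Γ)) :
    cons (v .zero) (fun _ i => v (.succ i)) = v := by
  funext t i
  cases i <;> rfl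

theorem exists_append : ∀ {Γ Δ : List S} (v : Tuple A (Γ ++ Δ)),
    ∃ (w : Tuple A Γ) (w' : Tuple A Δ), v = append w w'
  | [], _, v => ⟨nil, v, rfl⟩
  | _ :: _, _, v => by
    obtain ⟨w, w', h⟩ := exists_append fun _ i => v (.succ i)
    refine ⟨cons (v .zero) w, w', ?_⟩
    funext t i
    cases i with
    | zero => rfl
    | succ i => exact congrFun (congrFun h t) i

end Tuple

/-! ## Semantics of renaming and of derived connectives -/

section Semantics

variable {σ : Signature.{u}}

theorem Term.eval_rename (M : Str σ) {Γ Δ : List σ.Sorts} (ρ : Tuple (Var Δ) Γ)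
    (v : Tuple M.carrier Δ) : ∀ {s : σ.Sorts} (t : Term σ Γ s),
    (t.rename ρ).eval M v = t.eval M (fun _ i => v (ρ i))
  | _, .var _ => rfl
  | _, .app f ts => by
    simp only [Term.rename, Term.eval]
    congr 1
    funext t i
    exact Term.eval_rename M ρ v (ts i)

theorem Term.map_eval {M N : Str σ} (h : Str.Hom M N) {Γ : List σ.Sorts} (v : Tuple M.carrier Γ) :
    ∀ {s : σ.Sorts} (t : Term σ Γ s),
      h.toFun s (t.eval M v) = t.eval N (fun s i => h.toFun s (v i))
  | _, .var _ => rfl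
  | _, .app f ts => by
    simp only [Term.eval, h.map_fun]
    congr 1
    funext t i
    exact Term.map_eval h v (ts i)

namespace Formula

variable {M : Str σ}

theorem realize_rename : ∀ {Γ Δ : List σ.Sorts} (ρ : Tuple (Var Δ) Γ) (φ : Formula σ Γ)
    (v : Tuple M.carrier Δ), (φ.rename ρ).Realize M v ↔ φ.Realize M (fun _ i => v (ρ i))
  | _, _, ρ, .eq t t', v => by simp only [rename, Realize, Term.eval_rename]
  | _, _, ρ, .rel R ts, v => by simp only [rename, Realize, Term.eval_rename]
  | _, _, ρ, .not φ, v => not_congr (realize_rename ρ φ v)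
  | _, _, ρ, .all φ, v => forall_congr' fun x => by
    rw [realize_rename (Var.lift ρ) φ, Tuple.cons_comp_lift]
  | _, _, ρ, .ex φ, v => exists_congr fun x => by
    rw [realize_rename (Var.lift ρ) φ, Tuple.cons_comp_lift]
  | _, _, ρ, .conj φ, v => forall_congr' fun i => realize_rename ρ (φ i) v
  | _, _, ρ, .disj φ, v => exists_congr fun i => realize_rename ρ (φ i) v

theorem realize_rename_left {Γ Δ : List σ.Sorts} (φ : Formula σ Γ) (v : Tuple M.carrier Γ)
    (w : Tuple M.carrier Δ) :
    (φ.rename (Var.left Δ)).Realize M (v.append w) ↔ φ.Realize M v := by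
  rw [realize_rename]
  simp only [Tuple.append_left]

theorem realize_and {Γ : List σ.Sorts} (φ ψ : Formula σ Γ) (v : Tuple M.carrier Γ) :
    (φ.and ψ).Realize M v ↔ φ.Realize M v ∧ ψ.Realize M v :=
  ⟨fun h => ⟨h ⟨true⟩, h ⟨false⟩⟩, fun h => by rintro ⟨_ | _⟩; exacts [h.2, h.1]⟩

theorem realize_imp {Γ : List σ.Sorts} (φ ψ : Formula σ Γ) (v : Tuple M.carrier Γ) :
    (φ.imp ψ).Realize M v ↔ (φ.Realize M v → ψ.Realize M v) := by
  constructor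
  · rintro ⟨⟨_ | _⟩, h⟩ h'
    exacts [h, absurd h' h]
  · intro h
    by_cases h' : φ.Realize M v
    · exact ⟨⟨false⟩, h h'⟩
    · exact ⟨⟨true⟩, h'⟩

theorem realize_top {Γ : List σ.Sorts} (v : Tuple M.carrier Γ) : (top : Formula σ Γ).Realize M v :=
  fun i => nomatch i

theorem not_realize_bot {Γ : List σ.Sorts} (v : Tuple M.carrier Γ) :
    ¬ (bot : Formula σ Γ).Realize M v :=
  fun ⟨i, _⟩ => nomatch i

theorem realize_bigAnd {Γ : List σ.Sorts} {I : Type w} [Small.{u} I] (φ : I → Formula σ Γ)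
    (v : Tuple M.carrier Γ) : (bigAnd φ).Realize M v ↔ ∀ i, (φ i).Realize M v :=
  ⟨fun h i => by simpa using h (equivShrink I i), fun h _ => h _⟩

theorem realize_bigOr {Γ : List σ.Sorts} {I : Type w} [Small.{u} I] (φ : I → Formula σ Γ)
    (v : Tuple M.carrier Γ) : (bigOr φ).Realize M v ↔ ∃ i, (φ i).Realize M v :=
  ⟨fun ⟨_, h⟩ => ⟨_, h⟩, fun ⟨i, h⟩ => ⟨equivShrink I i, by simpa using h⟩⟩

theorem realize_exs : ∀ (Δ : List σ.Sorts) {Γ : List σ.Sorts} (φ : Formula σ (Δ ++ Γ))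
    (v : Tuple M.carrier Γ), (exs Δ φ).Realize M v ↔ ∃ w : Tuple M.carrier Δ,
      φ.Realize M (w.append v)
  | [], _, φ, v => ⟨fun h => ⟨Tuple.nil, h⟩, fun ⟨_, h⟩ => h⟩
  | _ :: Δ, _, φ, v => by
    refine (realize_exs Δ (.ex φ) v).trans ⟨?_, ?_⟩
    · rintro ⟨w, x, h⟩
      exact ⟨Tuple.cons x w, h⟩
    · rintro ⟨w, h⟩
      exact ⟨fun _ i => w (.succ i), w .zero, h⟩

theorem realize_alls : ∀ (Δ : List σ.Sorts) {Γ : List σ.Sorts} (φ : Formula σ (Δ ++ Γ))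
    (v : Tuple M.carrier Γ), (alls Δ φ).Realize M v ↔ ∀ w : Tuple M.carrier Δ,
      φ.Realize M (w.append v)
  | [], _, φ, v => ⟨fun h _ => h, fun h => h Tuple.nil⟩
  | _ :: Δ, _, φ, v => by
    refine (realize_alls Δ (.all φ) v).trans ⟨?_, ?_⟩
    · intro h w
      exact h (fun _ i => w (.succ i)) (w .zero)
    · intro h w x
      exact h (Tuple.cons x w)

end Formula

/-! ## Regular and cartesian formulae -/

namespace RegFormula

variable {M N : Str σ}

theorem realize_eq {Γ : List σ.Sorts} {s : σ.Sorts} (t t' : Term σ Γ s) (v : Tuple M.carrier Γ) :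
    (RegFormula.eq t t').Realize M v ↔ t.eval M v = t'.eval M v := Iff.rfl

theorem realize_rel {Γ ar : List σ.Sorts} (R : σ.Rel ar)
    (ts : ∀ ⦃t : σ.Sorts⦄, Var ar t → Term σ Γ t) (v : Tuple M.carrier Γ) :
    (RegFormula.rel R ts).Realize M v ↔ M.RelMap R (fun _ i => (ts i).eval M v) := Iff.rfl

theorem realize_top {Γ : List σ.Sorts} (v : Tuple M.carrier Γ) :
    (RegFormula.top : RegFormula σ Γ).Realize M v :=
  Formula.realize_top v

theorem realize_and {Γ : List σ.Sorts} (φ ψ : RegFormula σ Γ) (v : Tuple M.carrier Γ) :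
    (φ.and ψ).Realize M v ↔ φ.Realize M v ∧ ψ.Realize M v :=
  Formula.realize_and _ _ v

theorem realize_ex {Γ : List σ.Sorts} {s : σ.Sorts} (φ : RegFormula σ (s :: Γ))
    (v : Tuple M.carrier Γ) :
    φ.ex.Realize M v ↔ ∃ x, φ.Realize M (Tuple.cons x v) := Iff.rfl

/-- Homomorphisms preserve regular formulae. -/
theorem Realize.map (h : Str.Hom M N) : ∀ {Γ : List σ.Sorts} {φ : RegFormula σ Γ}
    {v : Tuple M.carrier Γ}, φ.Realize M v → φ.Realize N (fun s i => h.toFun s (v i))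
  | _, .eq t t', v, hv => by
    rw [realize_eq] at hv ⊢
    rw [← Term.map_eval, ← Term.map_eval, hv]
  | _, .rel R ts, v, hv => by
    rw [realize_rel] at hv ⊢
    simpa only [Term.map_eval] using h.map_rel R _ hv
  | _, .top, _, _ => realize_top _
  | _, .and φ ψ, v, hv => by
    rw [realize_and] at hv ⊢
    exact ⟨hv.1.map h, hv.2.map h⟩
  | _, .ex φ, v, hv => by
    rw [realize_ex] at hv ⊢
    obtain ⟨x, hx⟩ := hv
    exact ⟨h.toFun _ x, by simpa only [Tuple.map_cons] using hx.map h⟩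

/-- Renaming of variables in regular formulae. -/
def rename : ∀ {Γ Δ : List σ.Sorts}, Tuple (Var Δ) Γ → RegFormula σ Γ → RegFormula σ Δ
  | _, _, ρ, .eq t t' => .eq (t.rename ρ) (t'.rename ρ)
  | _, _, ρ, .rel R ts => .rel R (fun _ i => (ts i).rename ρ)
  | _, _, _, .top => .top
  | _, _, ρ, .and φ ψ => .and (φ.rename ρ) (ψ.rename ρ)
  | _, _, ρ, .ex φ => .ex (φ.rename (Var.lift ρ))

theorem realize_rename : ∀ {Γ Δ : List σ.Sorts} (ρ : Tuple (Var Δ) Γ) (φ : RegFormula σ Γ)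
    (v : Tuple M.carrier Δ), (φ.rename ρ).Realize M v ↔ φ.Realize M (fun _ i => v (ρ i))
  | _, _, ρ, .eq t t', v => by simp only [rename, realize_eq, Term.eval_rename]
  | _, _, ρ, .rel R ts, v => by simp only [rename, realize_rel, Term.eval_rename]
  | _, _, ρ, .top, v => iff_of_true (realize_top _) (realize_top _)
  | _, _, ρ, .and φ ψ, v => by
    simp only [rename, realize_and, realize_rename ρ φ, realize_rename ρ ψ]
  | _, _, ρ, .ex φ, v => exists_congr fun x => by
    have := realize_rename (Var.lift ρ) φ (Tuple.cons x v)
    rwa [Tuple.cons_comp_lift] at this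

theorem realize_map_cons {A : σ.Sorts → Type u} (f : ∀ s, A s → M.carrier s) {Γ : List σ.Sorts}
    {s : σ.Sorts} (φ : RegFormula σ (s :: Γ)) (x : A s) (v : Tuple A Γ) :
    (φ.Realize M fun t i => f t ((Tuple.cons x v : Tuple A (s :: Γ)) i)) ↔
      φ.Realize M (Tuple.cons (f s x) fun t i => f t (v i)) :=
  iff_of_eq (congrArg _ (Tuple.map_cons f x v))

theorem realize_rename_cons {Γ Δ : List σ.Sorts} {s : σ.Sorts} (i : Var Δ s)
    (ρ : Tuple (Var Δ) Γ) (φ : RegFormula σ (s :: Γ)) (v : Tuple M.carrier Δ) :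
    (φ.rename (Tuple.cons i ρ)).Realize M v ↔
      φ.Realize M (Tuple.cons (v i) (fun _ j => v (ρ j))) := by
  rw [realize_rename]
  exact realize_map_cons (A := Var Δ) (fun _ j => v j) φ i ρ

theorem IsCartesian.rename {T : RegTheory σ} : ∀ {Γ Δ : List σ.Sorts} (ρ : Tuple (Var Δ) Γ)
    {φ : RegFormula σ Γ}, φ.IsCartesian T → (φ.rename ρ).IsCartesian T
  | _, _, _, .eq _ _, _ => trivial
  | _, _, _, .rel _ _, _ => trivial
  | _, _, _, .top, _ => trivial
  | _, _, ρ, .and _ _, h => ⟨IsCartesian.rename ρ h.1, IsCartesian.rename ρ h.2⟩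
  | _, _, ρ, .ex φ, h => ⟨IsCartesian.rename (Var.lift ρ) h.1, fun M hM v x x' hx hx' => by
    rw [realize_rename, Tuple.cons_comp_lift] at hx hx'
    exact h.2 M hM _ x x' hx hx'⟩

/-- A larger theory has fewer models in which uniqueness must hold. This matters because an axiom is
only assumed cartesian over the axioms preceding it. -/
theorem IsCartesian.mono {T T' : RegTheory σ} (hT : T ⊆ T') : ∀ {Γ : List σ.Sorts}
    {φ : RegFormula σ Γ}, φ.IsCartesian T → φ.IsCartesian T'
  | _, .eq _ _, _ => trivial
  | _, .rel _ _, _ => trivial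
  | _, .top, _ => trivial
  | _, .and _ _, h => ⟨IsCartesian.mono hT h.1, IsCartesian.mono hT h.2⟩
  | _, .ex _, h => ⟨IsCartesian.mono hT h.1, fun M hM => h.2 M fun τ hτ => hM τ (hT hτ)⟩

/-- The conjunction of a family of regular formulae indexed by the variables of a context. -/
def conjVar {Γ : List σ.Sorts} : ∀ {Δ : List σ.Sorts},
    (∀ s : σ.Sorts, Var Δ s → RegFormula σ Γ) → RegFormula σ Γ
  | [], _ => .top
  | s :: _, φ => .and (φ s .zero) (conjVar fun t i => φ t (.succ i))

theorem realize_conjVar {Γ : List σ.Sorts} (v : Tuple M.carrier Γ) : ∀ {Δ : List σ.Sorts}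
    (φ : ∀ s : σ.Sorts, Var Δ s → RegFormula σ Γ),
    (conjVar φ).Realize M v ↔ ∀ s i, (φ s i).Realize M v
  | [], _ => iff_of_true (realize_top _) fun _ i => nomatch i
  | s :: Δ, φ => by
    rw [conjVar, realize_and, realize_conjVar]
    refine ⟨fun h t i => ?_, fun h => ⟨h _ _, fun _ _ => h _ _⟩⟩
    cases i
    exacts [h.1, h.2 _ _]

theorem IsCartesian.conjVar {T : RegTheory σ} {Γ : List σ.Sorts} : ∀ {Δ : List σ.Sorts}
    {φ : ∀ s : σ.Sorts, Var Δ s → RegFormula σ Γ}, (∀ s i, (φ s i).IsCartesian T) →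
    (conjVar φ).IsCartesian T
  | [], _, _ => trivial
  | _ :: _, _, h => ⟨h _ _, IsCartesian.conjVar fun _ _ => h _ _⟩

/-- Existential quantification over a block of variables. -/
def exs : ∀ (Δ : List σ.Sorts) {Γ : List σ.Sorts}, RegFormula σ (Δ ++ Γ) → RegFormula σ Γ
  | [], _, φ => φ
  | _ :: Δ, _, φ => exs Δ (.ex φ)

theorem realize_exs : ∀ (Δ : List σ.Sorts) {Γ : List σ.Sorts} (φ : RegFormula σ (Δ ++ Γ))
    (v : Tuple M.carrier Γ), (exs Δ φ).Realize M v ↔ ∃ w : Tuple M.carrier Δ,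
      φ.Realize M (w.append v)
  | [], _, φ, v => ⟨fun h => ⟨Tuple.nil, h⟩, fun ⟨_, h⟩ => h⟩
  | _ :: Δ, _, φ, v => by
    refine (realize_exs Δ (.ex φ) v).trans ⟨?_, ?_⟩
    · rintro ⟨w, x, h⟩
      exact ⟨Tuple.cons x w, h⟩
    · rintro ⟨w, h⟩
      exact ⟨fun _ i => w (.succ i), w .zero, h⟩

/-- Uniqueness of the whole block gives uniqueness of its first variable when the others are fixed,
and uniqueness of the remaining block once the first variable has been quantified. -/
theorem IsCartesian.exs {T : RegTheory σ} : ∀ (Δ : List σ.Sorts) {Γ : List σ.Sorts}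
    {φ : RegFormula σ (Δ ++ Γ)}, φ.IsCartesian T →
    (∀ M : Str σ, T.IsModel M → ∀ (v : Tuple M.carrier Γ) (w w' : Tuple M.carrier Δ),
      φ.Realize M (w.append v) → φ.Realize M (w'.append v) → w = w') →
    (exs Δ φ).IsCartesian T
  | [], _, _, h, _ => h
  | _ :: Δ, _, φ, h, hu => by
    refine IsCartesian.exs Δ (φ := .ex φ) ⟨h, fun M hM v x x' hx hx' => ?_⟩ ?_
    · obtain ⟨w, v, rfl⟩ := Tuple.exists_append v
      exact (Tuple.cons_inj (hu M hM v (Tuple.cons x w) (Tuple.cons x' w) hx hx')).1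
    · rintro M hM v w w' ⟨x, hx⟩ ⟨x', hx'⟩
      exact (Tuple.cons_inj (hu M hM v (Tuple.cons x w) (Tuple.cons x' w') hx hx')).2

end RegFormula

end Semantics

/-! ## The model presented by a cartesian formula -/

section Presentation

variable {σ : Signature.{u}} {T : RegTheory σ}

/-- A model of `T` with a tuple of elements that satisfies `φ`. -/
structure PointedModel (T : RegTheory σ) {Γ : List σ.Sorts} (φ : RegFormula σ Γ) where
  model : ModCat T
  point : model.Tup Γ
  realize : φ.Realize model.obj point

/-- A cartesian formula `θ(y, x)` that defines a function of the tuples `x` satisfying `φ`. -/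
structure DefFun (T : RegTheory σ) {Γ : List σ.Sorts} (φ : RegFormula σ Γ) (s : σ.Sorts) where
  formula : RegFormula σ (s :: Γ)
  cartesian : formula.IsCartesian T
  unique : ∀ M : Str σ, T.IsModel M → ∀ (x : Tuple M.carrier Γ) (y y' : M.carrier s),
    formula.Realize M (Tuple.cons y x) → formula.Realize M (Tuple.cons y' x) → y = y'
  total : ∀ M : Str σ, T.IsModel M → ∀ x : Tuple M.carrier Γ, φ.Realize M x →
    ∃ y, formula.Realize M (Tuple.cons y x)

namespace DefFun

variable {Γ : List σ.Sorts} {φ : RegFormula σ Γ} {s : σ.Sorts}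

/-- The value of a definable function. -/
noncomputable def val (d : DefFun T φ s) (p : PointedModel T φ) : p.model.obj.carrier s :=
  (d.total _ p.model.property _ p.realize).choose

theorem realize_val (d : DefFun T φ s) (p : PointedModel T φ) :
    d.formula.Realize p.model.obj (Tuple.cons (d.val p) p.point) :=
  (d.total _ p.model.property _ p.realize).choose_spec

theorem realize_iff (d : DefFun T φ s) (p : PointedModel T φ) (y : p.model.obj.carrier s) :
    d.formula.Realize p.model.obj (Tuple.cons y p.point) ↔ y = d.val p :=
  ⟨fun h => d.unique _ p.model.property _ _ _ h (d.realize_val p), fun h => h ▸ d.realize_val p⟩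

/-- The projection onto a variable. -/
def proj (T : RegTheory σ) (φ : RegFormula σ Γ) (i : Var Γ s) : DefFun T φ s where
  formula := .eq (.var .zero) (.var (.succ i))
  cartesian := trivial
  unique _ _ _ _ _ h h' := Eq.trans h (Eq.symm h')
  total _ _ x _ := ⟨x i, rfl⟩

theorem val_proj (i : Var Γ s) (p : PointedModel T φ) : (proj T φ i).val p = p.point i :=
  ((proj T φ i).realize_iff p _).1 rfl |>.symm

/-- If a cartesian formula `χ(z, y)` defines `z` in terms of the values `y` of definable functions,
then `z` is the value of a definable function. -/
theorem exists_of_existsUnique (hφ : φ.IsCartesian T) {Δ : List σ.Sorts} (d : ∀ t, Var Δ t → DefFun T φ t)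
    (χ : RegFormula σ (s :: Δ)) (hχ : χ.IsCartesian T)
    (h : ∀ p : PointedModel T φ,
      ∃! z, χ.Realize p.model.obj (Tuple.cons z (fun t i => (d t i).val p))) :
    ∃ e : DefFun T φ s, ∀ p : PointedModel T φ,
      χ.Realize p.model.obj (Tuple.cons (e.val p) (fun t i => (d t i).val p)) := by
  -- The graph of the composite: the block `Δ` of intermediate values stands first, so that
  -- quantifying it away leaves the context `z, x`.
  let θ : RegFormula σ (Δ ++ s :: Γ) := RegFormula.and
    (RegFormula.conjVar fun t (i : Var Δ t) => (d t i).formula.rename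
      (Tuple.cons (Var.left _ i) fun _ j => Var.right Δ (.succ j)))
    (χ.rename (Tuple.cons (Var.right Δ .zero) (Var.left _)))
  have hθ : ∀ (M : Str σ) (w : Tuple M.carrier Δ) (z : M.carrier s) (x : Tuple M.carrier Γ),
      θ.Realize M (w.append (Tuple.cons z x)) ↔
        (∀ t i, (d t i).formula.Realize M (Tuple.cons (w i) x)) ∧
          χ.Realize M (Tuple.cons z w) := by
    intro M w z x
    simp only [θ, RegFormula.realize_and, RegFormula.realize_conjVar,
      RegFormula.realize_rename_cons, Tuple.append_left, Tuple.append_right, Tuple.cons_zero,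
      Tuple.cons_succ]
  have hval : ∀ (p : PointedModel T φ) (z : p.model.obj.carrier s),
      (RegFormula.exs Δ θ).Realize p.model.obj (Tuple.cons z p.point) ↔
        χ.Realize p.model.obj (Tuple.cons z (fun t i => (d t i).val p)) := by
    intro p z
    simp only [RegFormula.realize_exs, hθ, realize_iff]
    constructor
    · rintro ⟨w, hw, h⟩
      obtain rfl : w = fun t i => (d t i).val p := by
        funext t i
        exact hw t i
      exact h
    · exact fun h => ⟨_, fun _ _ => rfl, h⟩
  have hval' : ∀ (p : PointedModel T φ) (z : p.model.obj.carrier s),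
      ((φ.rename fun _ i => .succ i).and (RegFormula.exs Δ θ)).Realize p.model.obj
        (Tuple.cons z p.point) ↔
        χ.Realize p.model.obj (Tuple.cons z (fun t i => (d t i).val p)) := by
    intro p z
    rw [RegFormula.realize_and, hval, RegFormula.realize_rename]
    exact and_iff_right p.realize
  let e : DefFun T φ s :=
    -- Uniqueness of `z` is only known at tuples satisfying `φ`, whereas a definable function must
    -- be single-valued at every tuple; hence the conjunct `φ`.
    { formula := (φ.rename fun _ i => .succ i).and (RegFormula.exs Δ θ)
      cartesian := by
        refine ⟨hφ.rename _, RegFormula.IsCartesian.exs Δ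
          ⟨RegFormula.IsCartesian.conjVar fun t i => (d t i).cartesian.rename _, hχ.rename _⟩ ?_⟩
        intro M hM v w w' hw hw'
        rw [← Tuple.cons_eta v, hθ] at hw hw'
        funext t i
        exact (d t i).unique M hM _ _ _ (hw.1 t i) (hw'.1 t i)
      unique := fun M hM x y y' hy hy' => by
        have hx : φ.Realize M x := by
          have := ((RegFormula.realize_and _ _ _).1 hy).1
          rwa [RegFormula.realize_rename] at this
        let p : PointedModel T φ := ⟨⟨M, hM⟩, x, hx⟩
        exact (h p).unique ((hval' p y).1 hy) ((hval' p y').1 hy')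
      total := fun M hM x hx => by
        let p : PointedModel T φ := ⟨⟨M, hM⟩, x, hx⟩
        obtain ⟨z, hz, -⟩ := h p
        exact ⟨z, (hval' p z).2 hz⟩ }
  exact ⟨e, fun p => (hval' p _).1 (e.realize_val p)⟩

end DefFun

/-- The elements of the model presented by `φ`: definable functions, up to equality of values. -/
abbrev PresCarrier (T : RegTheory σ) {Γ : List σ.Sorts} (φ : RegFormula σ Γ) (s : σ.Sorts) :
    Type u :=
  Quotient (Setoid.ker (DefFun.val (T := T) (φ := φ) (s := s)))

namespace PresCarrier

variable {Γ : List σ.Sorts} {φ : RegFormula σ Γ}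

/-- The value of an element of the model presented by `φ`. -/
noncomputable def val {s : σ.Sorts} (e : PresCarrier T φ s) (p : PointedModel T φ) :
    p.model.obj.carrier s :=
  Setoid.kerLift DefFun.val e p

theorem ext {s : σ.Sorts} {e e' : PresCarrier T φ s} (h : ∀ p, e.val p = e'.val p) : e = e' :=
  Setoid.kerLift_injective _ (funext h)

theorem exists_defFun {s : σ.Sorts} (e : PresCarrier T φ s) :
    ∃ d : DefFun T φ s, ∀ p, e.val p = d.val p := by
  obtain ⟨d, rfl⟩ := Quotient.exists_rep e
  exact ⟨d, fun _ => rfl⟩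

/-- The source of all new elements: it provides both the values of the function symbols and the
witnesses of cartesian existential quantifiers. -/
theorem exists_of_existsUnique (hφ : φ.IsCartesian T) {Δ : List σ.Sorts} {s : σ.Sorts}
    (v : Tuple (PresCarrier T φ) Δ) (χ : RegFormula σ (s :: Δ)) (hχ : χ.IsCartesian T)
    (h : ∀ p : PointedModel T φ,
      ∃! z, χ.Realize p.model.obj (Tuple.cons z (fun _ i => (v i).val p))) :
    ∃ e : PresCarrier T φ s, ∀ p : PointedModel T φ,
      χ.Realize p.model.obj (Tuple.cons (e.val p) (fun _ i => (v i).val p)) := by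
  choose d hd using fun t (i : Var Δ t) => (v i).exists_defFun
  simp only [hd] at h ⊢
  obtain ⟨e, he⟩ := DefFun.exists_of_existsUnique hφ d χ hχ h
  exact ⟨Quotient.mk _ e, he⟩

theorem exists_funMap (hφ : φ.IsCartesian T) {ar : List σ.Sorts} {s : σ.Sorts} (f : σ.Fun ar s)
    (v : Tuple (PresCarrier T φ) ar) : ∃ e : PresCarrier T φ s, ∀ p : PointedModel T φ,
      e.val p = p.model.obj.funMap f (fun _ i => (v i).val p) :=
  exists_of_existsUnique hφ v (.eq (.var .zero) (.app f fun _ i => .var (.succ i))) trivial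
    fun p => ⟨p.model.obj.funMap f (fun _ i => (v i).val p), Eq.refl _, fun _ h => h⟩

end PresCarrier

/-! ### The structure of definable functions and its truth lemma -/

variable {Γ : List σ.Sorts} {φ : RegFormula σ Γ}

/-- The structure underlying the model presented by `φ`. -/
noncomputable def presStr (hφ : φ.IsCartesian T) : Str σ where
  carrier := PresCarrier T φ
  funMap f v := (PresCarrier.exists_funMap hφ f v).choose
  RelMap R v := ∀ p : PointedModel T φ, p.model.obj.RelMap R (fun _ i => (v i).val p)

/-- The values of the elements of `presStr` at a pointed model form a homomorphism. -/
noncomputable def presStrVal (hφ : φ.IsCartesian T) (p : PointedModel T φ) :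
    Str.Hom (presStr hφ) p.model.obj where
  toFun _ e := PresCarrier.val e p
  map_fun f v := (PresCarrier.exists_funMap hφ f v).choose_spec p
  map_rel _ _ h := h p

/-- A cartesian formula holds in the presented structure iff it holds at all pointed models. -/
theorem presStr_realize_iff (hφ : φ.IsCartesian T) : ∀ {Δ : List σ.Sorts} {ψ : RegFormula σ Δ}
    (_ : ψ.IsCartesian T) (v : Tuple (presStr hφ).carrier Δ),
    ψ.Realize (presStr hφ) v ↔ ∀ p : PointedModel T φ,
      ψ.Realize p.model.obj (fun s i => (presStrVal hφ p).toFun s (v i))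
  | _, .eq t t', _, v => by
    simp only [RegFormula.realize_eq, ← Term.map_eval]
    exact ⟨fun h p => by rw [h], fun h => PresCarrier.ext h⟩
  | _, .rel R ts, _, v => by
    simp only [RegFormula.realize_rel, ← Term.map_eval]
    rfl
  | _, .top, _, v => iff_of_true (RegFormula.realize_top _) fun _ => RegFormula.realize_top _
  | _, .and ψ ψ', h, v => by
    simp only [RegFormula.realize_and, presStr_realize_iff hφ h.1, presStr_realize_iff hφ h.2,
      forall_and]
  | _, .ex ψ, h, v => by
    refine ⟨fun hv p => hv.map _, fun hv => ?_⟩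
    -- Witnesses exist separately at each pointed model. Being unique, they are the values of a
    -- single definable function, which is a witness in the presented structure.
    obtain ⟨e, he⟩ := PresCarrier.exists_of_existsUnique hφ v ψ h.1 fun p => by
      obtain ⟨z, hz⟩ := hv p
      exact ⟨z, hz, fun z' hz' => h.2 _ p.model.property _ _ _ hz' hz⟩
    refine ⟨e, (presStr_realize_iff hφ h.1 _).2 fun p => ?_⟩
    exact (RegFormula.realize_map_cons (presStrVal hφ p).toFun ψ e v).2 (he p)

/-- Both sides of an axiom are cartesian over `T`, so the truth lemma reduces the axiom to its
validity in every pointed model. -/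
theorem presStr_isModel (hT : T.IsCartesian) (hφ : φ.IsCartesian T) :
    T.IsModel (presStr hφ) := by
  obtain ⟨r, -, -, hr⟩ := hT
  intro τ hτ v hv
  have hsub : {τ' | ∃ h : τ' ∈ T, r ⟨τ', h⟩ ⟨τ, hτ⟩} ⊆ T := fun _ h => h.1
  rw [presStr_realize_iff hφ ((hr ⟨τ, hτ⟩).1.mono hsub)] at hv
  rw [presStr_realize_iff hφ ((hr ⟨τ, hτ⟩).2.mono hsub)]
  exact fun p => p.model.property τ hτ _ (hv p)

/-! ### The universal property of the presented model -/

namespace ModCat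

@[simp] theorem mapTup_comp {a b c : ModCat T} (f : a ⟶ b) (g : b ⟶ c) {Δ : List σ.Sorts}
    (v : a.Tup Δ) : mapTup (f ≫ g) v = mapTup g (mapTup f v) := rfl

theorem realize_mapTup {a b : ModCat T} (f : a ⟶ b) {Δ : List σ.Sorts} {ψ : RegFormula σ Δ}
    {v : a.Tup Δ} (h : ψ.Realize a.obj v) : ψ.Realize b.obj (mapTup f v) :=
  RegFormula.Realize.map f.hom h

theorem realize_cons_map {a b : ModCat T} (f : a ⟶ b) {Δ : List σ.Sorts} {s : σ.Sorts}
    {ψ : RegFormula σ (s :: Δ)} {x : a.obj.carrier s} {v : a.Tup Δ}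
    (h : ψ.Realize a.obj (Tuple.cons x v)) :
    ψ.Realize b.obj (Tuple.cons (f.hom.toFun s x) (mapTup f v)) := by
  exact (RegFormula.realize_map_cons f.hom.toFun ψ x v).1 (realize_mapTup f h)

theorem hom_ext_toFun {a b : ModCat T} {f g : a ⟶ b}
    (h : ∀ s x, f.hom.toFun s x = g.hom.toFun s x) : f = g :=
  ObjectProperty.hom_ext _ (Str.Hom.ext (funext fun s => funext fun x => h s x))

/-- The model presented by a cartesian formula. -/
noncomputable def pres (hT : T.IsCartesian) (hφ : φ.IsCartesian T) : ModCat T :=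
  ⟨presStr hφ, presStr_isModel hT hφ⟩

/-- The generators of the model presented by a cartesian formula. -/
noncomputable def presGen (hT : T.IsCartesian) (hφ : φ.IsCartesian T) : (pres hT hφ).Tup Γ :=
  fun _ i => (Quotient.mk _ (DefFun.proj T φ i) : PresCarrier T φ _)

theorem map_presGen (hT : T.IsCartesian) (hφ : φ.IsCartesian T) (p : PointedModel T φ) :
    (fun s i => (presStrVal hφ p).toFun s (presGen hT hφ i)) = p.point := by
  funext s i
  exact DefFun.val_proj i p

/-- A definable function, as an element, is the value of its own formula at the generators. By the
truth lemma this may be checked at pointed models, where the generators become the distinguished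
point. -/
theorem exists_defFun_pres (hT : T.IsCartesian) (hφ : φ.IsCartesian T) {s : σ.Sorts}
    (e : (pres hT hφ).obj.carrier s) : ∃ d : DefFun T φ s,
      d.formula.Realize (pres hT hφ).obj (Tuple.cons e (presGen hT hφ)) := by
  obtain ⟨d, hd⟩ := PresCarrier.exists_defFun e
  refine ⟨d, (presStr_realize_iff hφ d.cartesian _).2 fun p => ?_⟩
  refine (RegFormula.realize_map_cons (presStrVal hφ p).toFun d.formula e (presGen hT hφ)).2 ?_
  rw [map_presGen]
  exact (d.realize_iff p _).2 (hd p)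

/-- Evaluation at `(b, c)` is a homomorphism sending the projections to `c`. It is the only one:
each element is defined from the generators by a formula that homomorphisms preserve and that has at
most one solution in `b`. -/
theorem isPresentedBy_pres (hT : T.IsCartesian) (hφ : φ.IsCartesian T) :
    (pres hT hφ).IsPresentedBy φ (presGen hT hφ) where
  realize := (presStr_realize_iff hφ hφ _).2 fun p => by
    rw [map_presGen]
    exact p.realize
  existsUnique b c hc := by
    refine ⟨⟨presStrVal hφ ⟨b, c, hc⟩⟩, map_presGen hT hφ ⟨b, c, hc⟩, fun h hh => ?_⟩
    refine hom_ext_toFun fun s e => ?_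
    obtain ⟨d, hd⟩ := exists_defFun_pres hT hφ e
    have key : ∀ h : pres hT hφ ⟶ b, mapTup h (presGen hT hφ) = c →
        h.hom.toFun s e = d.val ⟨b, c, hc⟩ := by
      rintro h rfl
      exact (d.realize_iff ⟨b, _, hc⟩ _).1 (realize_cons_map h hd)
    exact (key h hh).trans (key _ (map_presGen hT hφ ⟨b, c, hc⟩)).symm

namespace IsPresentedBy

variable {a : ModCat T} {g : a.Tup Γ}

theorem hom_ext (ha : a.IsPresentedBy φ g) {b : ModCat T} {f f' : a ⟶ b}
    (h : mapTup f g = mapTup f' g) : f = f' :=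
  (ha.existsUnique b _ (realize_mapTup f' ha.realize)).unique h rfl

theorem exists_hom (ha : a.IsPresentedBy φ g) {b : ModCat T} {c : b.Tup Γ}
    (hc : φ.Realize b.obj c) : ∃ f : a ⟶ b, mapTup f g = c :=
  (ha.existsUnique b c hc).exists

theorem nonempty_iso (ha : a.IsPresentedBy φ g) {b : ModCat T} {g' : b.Tup Γ}
    (hb : b.IsPresentedBy φ g') : Nonempty (a ≅ b) := by
  obtain ⟨f, hf⟩ := ha.exists_hom hb.realize
  obtain ⟨k, hk⟩ := hb.exists_hom ha.realize
  exact ⟨f, k, ha.hom_ext (by rw [mapTup_comp, hf, hk]; rfl),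
    hb.hom_ext (by rw [mapTup_comp, hk, hf]; rfl)⟩

/-- The elements of a presented model are definable from the generators. -/
theorem exists_defFun (ha : a.IsPresentedBy φ g) (hT : T.IsCartesian) (hφ : φ.IsCartesian T)
    {s : σ.Sorts} (e : a.obj.carrier s) :
    ∃ d : DefFun T φ s, d.formula.Realize a.obj (Tuple.cons e g) := by
  obtain ⟨f, hf⟩ := ha.exists_hom (isPresentedBy_pres hT hφ).realize
  obtain ⟨k, hk⟩ := (isPresentedBy_pres hT hφ).exists_hom ha.realize
  obtain ⟨d, hd⟩ := exists_defFun_pres hT hφ (f.hom.toFun s e)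
  -- The definition of `f e` in the syntactic model is carried back by `k`; since `f ≫ k` fixes the
  -- generators, it defines `e` itself.
  have hfk : f ≫ k = 𝟙 a := ha.hom_ext (by rw [mapTup_comp, hf, hk]; rfl)
  have := realize_cons_map k hd
  rw [hk] at this
  refine ⟨d, ?_⟩
  convert this
  exact congrArg (fun h : a ⟶ a => h.hom.toFun s e) hfk.symm

end IsPresentedBy

end ModCat

end Presentation

/-! ## Finitely presentable models are presented by cartesian formulae -/

namespace ModCat

variable {σ : Signature.{u}} {T : RegTheory σ}

/-- A tuple of elements of `A` that satisfies a cartesian formula. -/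
structure PresPoint (A : ModCat T) where
  ctx : List σ.Sorts
  formula : RegFormula σ ctx
  cartesian : formula.IsCartesian T
  point : A.Tup ctx
  realize : formula.Realize A.obj point

/-! ### The filtered diagram of presented models over a model -/

namespace PresPoint

variable {A : ModCat T} (hT : T.IsCartesian)

/-- The presented model, over `A`. -/
noncomputable def toOver (j : PresPoint A) : Over A :=
  Over.mk ((isPresentedBy_pres hT j.cartesian).exists_hom j.realize).choose

/-- The generators of the presented model. -/
noncomputable def gen (j : PresPoint A) : (j.toOver hT).left.Tup j.ctx := presGen hT j.cartesian

theorem isPresentedBy (j : PresPoint A) :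
    (j.toOver hT).left.IsPresentedBy j.formula (j.gen hT) := isPresentedBy_pres hT j.cartesian

theorem map_gen (j : PresPoint A) : mapTup (j.toOver hT).hom (j.gen hT) = j.point :=
  ((isPresentedBy_pres hT j.cartesian).exists_hom j.realize).choose_spec

/-- Compatibility with the maps to `A` need only be checked on generators. -/
theorem exists_over_hom (j : PresPoint A) (X : Over A) (c : X.left.Tup j.ctx)
    (hc : j.formula.Realize X.left.obj c) (h : mapTup X.hom c = j.point) :
    ∃ f : j.toOver hT ⟶ X, mapTup f.left (j.gen hT) = c := by
  obtain ⟨f, hf⟩ := (j.isPresentedBy hT).exists_hom hc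
  refine ⟨Over.homMk f ((j.isPresentedBy hT).hom_ext ?_), hf⟩
  rw [mapTup_comp, hf, h]
  exact (j.map_gen hT).symm

/-- An element of `A`, as a tuple of length one. -/
def ofElem {s : σ.Sorts} (x : A.obj.carrier s) : PresPoint A :=
  ⟨[s], .top, trivial, Tuple.cons x Tuple.nil, RegFormula.realize_top _⟩

/-- The category of the models over `A` presented by cartesian formulae. -/
abbrev Diag (A : ModCat T) := InducedCategory (Over A) (toOver (A := A) hT)

/-- Two objects are joined by the conjunction of their formulae in the concatenated context. Two
parallel arrows are equalised by adding to the target's formula the condition that they agree on the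
generators of the source. -/
theorem isFiltered_diag : IsFiltered (Diag hT A) where
  nonempty := ⟨(⟨[], .top, trivial, Tuple.nil, RegFormula.realize_top _⟩ : PresPoint A)⟩
  cocone_objs (j k : PresPoint A) := by
    have hl : ∀ {M : Str σ} (v : Tuple M.carrier (j.ctx ++ k.ctx)),
        ((j.formula.rename (Var.left _)).and (k.formula.rename (Var.right _))).Realize M v ↔
          j.formula.Realize M (fun _ i => v (Var.left _ i)) ∧
          k.formula.Realize M (fun _ i => v (Var.right _ i)) := by
      intro M v
      rw [RegFormula.realize_and, RegFormula.realize_rename, RegFormula.realize_rename]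
    let l : PresPoint A :=
      { ctx := j.ctx ++ k.ctx
        formula := (j.formula.rename (Var.left _)).and (k.formula.rename (Var.right _))
        cartesian := ⟨j.cartesian.rename _, k.cartesian.rename _⟩
        point := Tuple.append j.point k.point
        realize := by
          rw [hl]
          simp only [Tuple.append_left, Tuple.append_right]
          exact ⟨j.realize, k.realize⟩ }
    have hgen := (hl _).1 (l.isPresentedBy hT).realize
    have hpt : ∀ t (i : Var (j.ctx ++ k.ctx) t),
        (l.toOver hT).hom.hom.toFun t (l.gen hT i) = Tuple.append j.point k.point i :=
      fun t i => congrFun (congrFun (l.map_gen hT) t) i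
    obtain ⟨f, -⟩ := j.exists_over_hom hT (l.toOver hT) _ hgen.1 (by
      funext t i
      exact (hpt t _).trans (Tuple.append_left _ _ i))
    obtain ⟨g, -⟩ := k.exists_over_hom hT (l.toOver hT) _ hgen.2 (by
      funext t i
      exact (hpt t _).trans (Tuple.append_right _ _ i))
    exact ⟨l, ⟨f⟩, ⟨g⟩, trivial⟩
  cocone_maps (j k : PresPoint A) f f' := by
    choose d hd using fun t (i : Var j.ctx t) => (k.isPresentedBy hT).exists_defFun hT k.cartesian
      (f.hom.left.hom.toFun t (j.gen hT i))
    choose d' hd' using fun t (i : Var j.ctx t) => (k.isPresentedBy hT).exists_defFun hT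
      k.cartesian (f'.hom.left.hom.toFun t (j.gen hT i))
    -- The formulae `d` and `d'` define the images of the `i`-th generator of `j` under the two
    -- arrows; the added clause says that they have a common value. Its quantifier is cartesian
    -- since `d` is single-valued, and the clause holds at `k.point` because both arrows lie over
    -- `A`, the common value being `j.point i`.
    let l : PresPoint A :=
      { ctx := k.ctx
        formula := k.formula.and (.conjVar fun t i => .ex ((d t i).formula.and (d' t i).formula))
        cartesian := ⟨k.cartesian, .conjVar fun t i => ⟨⟨(d t i).cartesian, (d' t i).cartesian⟩,
          fun M hM v x x' hx hx' => (d t i).unique M hM v x x'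
            ((RegFormula.realize_and _ _ _).1 hx).1 ((RegFormula.realize_and _ _ _).1 hx').1⟩⟩
        point := k.point
        realize := by
          rw [RegFormula.realize_and, RegFormula.realize_conjVar]
          refine ⟨k.realize, fun t i => ⟨j.point i, (RegFormula.realize_and _ _ _).2 ⟨?_, ?_⟩⟩⟩
          · have := realize_cons_map (k.toOver hT).hom (hd t i)
            rw [k.map_gen hT] at this
            rw [← j.map_gen hT, ← Over.w f.hom]
            exact this
          · have := realize_cons_map (k.toOver hT).hom (hd' t i)
            rw [k.map_gen hT] at this
            rw [← j.map_gen hT, ← Over.w f'.hom]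
            exact this }
    have hgen := (l.isPresentedBy hT).realize
    rw [RegFormula.realize_and, RegFormula.realize_conjVar] at hgen
    obtain ⟨q, hq⟩ := k.exists_over_hom hT (l.toOver hT) _ hgen.1 (l.map_gen hT)
    refine ⟨l, ⟨q⟩, InducedCategory.hom_ext (Over.OverMorphism.ext ?_)⟩
    refine (j.isPresentedBy hT).hom_ext ?_
    funext t i
    obtain ⟨y, hy⟩ := hgen.2 t i
    replace hy := (RegFormula.realize_and _ _ _).1 hy
    rw [← hq] at hy
    exact ((d t i).unique _ (l.toOver hT).left.property _ _ _
      (realize_cons_map q.left (hd t i)) hy.1).trans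
      ((d' t i).unique _ (l.toOver hT).left.property _ _ _
      (realize_cons_map q.left (hd' t i)) hy.2).symm

/-- The cocone of the presented models over `A`. -/
noncomputable def cocone (A : ModCat T) :
    Cocone (inducedFunctor (toOver (A := A) hT) ⋙ Over.forget A) where
  pt := A
  ι := { app := fun (j : PresPoint A) => (j.toOver hT).hom
         naturality := fun _ _ f => (Over.w f.hom).trans (Category.comp_id _).symm }

/-- The generator of the free model on one element can be sent to `e` over `A`, so naturality of the
cocone relates the two legs. Hence a leg's value at `e` depends only on the image of `e` in `A`. -/
theorem cocone_elem (s : Cocone (inducedFunctor (toOver (A := A) hT) ⋙ Over.forget A))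
    (j : PresPoint A) {t : σ.Sorts} (e : (j.toOver hT).left.obj.carrier t) :
    (s.ι.app (ofElem ((j.toOver hT).hom.hom.toFun t e))).hom.toFun t ((ofElem _).gen hT .zero) =
      (s.ι.app j).hom.toFun t e := by
  obtain ⟨f, hf⟩ := (ofElem ((j.toOver hT).hom.hom.toFun t e)).exists_over_hom hT (j.toOver hT)
    (Tuple.cons e Tuple.nil) (RegFormula.realize_top _) (by
      refine (Tuple.map_cons (j.toOver hT).hom.hom.toFun e Tuple.nil).trans ?_
      exact congrArg _ (by funext t i; cases i))
  let f' : (show Diag hT A from ofElem ((j.toOver hT).hom.hom.toFun t e)) ⟶ (show Diag hT A from j) :=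
    ⟨f⟩
  rw [← s.w f']
  exact congrArg ((s.ι.app j).hom.toFun t) (congrFun (congrFun hf t) .zero)

theorem map_gen_ofElem {t : σ.Sorts} (x : A.obj.carrier t) :
    ((ofElem x).toOver hT).hom.hom.toFun t ((ofElem x).gen hT .zero) = x :=
  congrFun (congrFun ((ofElem x).map_gen hT) t) .zero

theorem map_gen_apply (j : PresPoint A) {t : σ.Sorts} (i : Var j.ctx t) :
    (j.toOver hT).hom.hom.toFun t (j.gen hT i) = j.point i :=
  congrFun (congrFun (j.map_gen hT) t) i

/-- The map underlying the comparison from `A` to a cocone. -/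
noncomputable def descFun (s : Cocone (inducedFunctor (toOver (A := A) hT) ⋙ Over.forget A))
    (t : σ.Sorts) (x : A.obj.carrier t) : s.pt.obj.carrier t :=
  (s.ι.app (ofElem x)).hom.toFun t ((ofElem x).gen hT .zero)

/-- The comparison from `A` to a cocone. -/
noncomputable def descHom (s : Cocone (inducedFunctor (toOver (A := A) hT) ⋙ Over.forget A)) :
    Str.Hom A.obj s.pt.obj where
  toFun := descFun hT s
  map_fun {ar t} f v := by
    -- The arguments are lifted jointly to the free model on `ar`, so that a single leg of the
    -- cocone, a homomorphism, handles them all.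
    let j : PresPoint A := ⟨ar, .top, trivial, v, RegFormula.realize_top _⟩
    have hv : ∀ t (i : Var ar t), v i = (j.toOver hT).hom.hom.toFun t (j.gen hT i) :=
      fun t i => (map_gen_apply hT j i).symm
    have hf : A.obj.funMap f v =
        (j.toOver hT).hom.hom.toFun t ((j.toOver hT).left.obj.funMap f (j.gen hT)) := by
      rw [(j.toOver hT).hom.hom.map_fun]
      congr 1
      funext t i
      exact hv t i
    have key : ∀ t (e : (j.toOver hT).left.obj.carrier t),
        descFun hT s t ((j.toOver hT).hom.hom.toFun t e) = (s.ι.app j).hom.toFun t e :=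
      fun t e => cocone_elem hT s j e
    simp only [hf, hv, key]
    exact (s.ι.app j).hom.map_fun f (j.gen hT)
  map_rel {ar} R v h := by
    -- In the model freely generated by an `R`-related tuple, the relation already holds at the
    -- generators.
    let j : PresPoint A := ⟨ar, .rel R fun _ i => .var i, trivial, v, h⟩
    have hv : ∀ t (i : Var ar t), v i = (j.toOver hT).hom.hom.toFun t (j.gen hT i) :=
      fun t i => (map_gen_apply hT j i).symm
    have key : ∀ t (e : (j.toOver hT).left.obj.carrier t),
        descFun hT s t ((j.toOver hT).hom.hom.toFun t e) = (s.ι.app j).hom.toFun t e :=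
      fun t e => cocone_elem hT s j e
    simp only [hv, key]
    exact (s.ι.app j).hom.map_rel R (j.gen hT) (j.isPresentedBy hT).realize

/-- Every model is the colimit of the presented models over it. -/
noncomputable def isColimitCocone (A : ModCat T) : IsColimit (cocone hT A) where
  desc s := ⟨descHom hT s⟩
  fac s j := hom_ext_toFun fun t e => cocone_elem hT s j e
  uniq s m h := hom_ext_toFun fun t x => by
    have := congrArg (fun f => f.hom.toFun t ((ofElem x).gen hT .zero)) (h (ofElem x))
    refine Eq.trans ?_ this
    exact congrArg (m.hom.toFun t) (map_gen_ofElem hT x).symm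

end PresPoint

/-- Finite presentability factors the identity of `A` through a stage of the filtered colimit,
giving `r ≫ ε = 𝟙 A`. Thus `A` splits the idempotent `ε ≫ r` of some `⟨x ∣ φ⟩`, and homomorphisms
out of `A` correspond to those out of `⟨x ∣ φ⟩` that are invariant under it. If `d` defines the
image of `x` under the idempotent, invariance is the cartesian condition `d i (x i, x)` for all `i`.
-/
theorem exists_isPresentedBy (hT : T.IsCartesian) (A : ModCat T)
    (hA : IsFinitelyPresentable.{u} A) : ∃ (Γ : List σ.Sorts) (φ : RegFormula σ Γ) (g : A.Tup Γ),
      φ.IsCartesian T ∧ A.IsPresentedBy φ g := by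
  have := PresPoint.isFiltered_diag (A := A) hT
  obtain ⟨j, r, hr⟩ := IsFinitelyPresentable.exists_hom_of_isColimit
    (PresPoint.isColimitCocone hT A) (𝟙 A)
  change PresPoint A at j
  let ε : (j.toOver hT).left ⟶ A := (j.toOver hT).hom
  change A ⟶ (j.toOver hT).left at r
  change r ≫ ε = 𝟙 A at hr
  choose d hd using fun t (i : Var j.ctx t) => (j.isPresentedBy hT).exists_defFun hT j.cartesian
    ((ε ≫ r).hom.toFun t (j.gen hT i))
  have hφ : ∀ {M : Str σ} (v : Tuple M.carrier j.ctx),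
      (j.formula.and (.conjVar fun t i =>
        (d t i).formula.rename (Tuple.cons i fun _ k => k))).Realize M v ↔
      j.formula.Realize M v ∧ ∀ t i, (d t i).formula.Realize M (Tuple.cons (v i) v) := by
    intro M v
    rw [RegFormula.realize_and, RegFormula.realize_conjVar]
    simp only [RegFormula.realize_rename_cons]
  refine ⟨j.ctx, j.formula.and (.conjVar fun t i =>
    (d t i).formula.rename (Tuple.cons i fun _ k => k)), j.point,
    ⟨j.cartesian, .conjVar fun t i => (d t i).cartesian.rename _⟩, ⟨?_, ?_⟩⟩
  · refine (hφ _).2 ⟨j.realize, fun t i => ?_⟩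
    have := realize_cons_map ε (hd t i)
    rw [show mapTup ε (j.gen hT) = j.point from j.map_gen hT] at this
    convert this
    refine (j.map_gen_apply hT i).symm.trans ?_
    exact congrArg (fun f => f.hom.toFun t (ε.hom.toFun t (j.gen hT i))) hr.symm
  · intro b c hc
    rw [hφ] at hc
    obtain ⟨h, hh⟩ := (j.isPresentedBy hT).exists_hom hc.1
    refine ⟨r ≫ h, ?_, fun k hk => ?_⟩
    · change mapTup (r ≫ h) j.point = c
      funext t i
      have := realize_cons_map h (hd t i)
      rw [hh] at this
      rw [← j.map_gen hT]
      exact (d t i).unique _ b.property _ _ _ this (hc.2 t i)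
    -- As `ε` has the section `r`, a homomorphism `k` is determined by `ε ≫ k`, hence by its values
    -- at `j.point`.
    · have : ε ≫ k = h := (j.isPresentedBy hT).hom_ext (by
        rw [hh, ← hk, ← j.map_gen hT]; rfl)
      rw [← this, ← Category.assoc, hr, Category.id_comp]

end ModCat

/-! ## Existence of the choices for Hintikka formulae -/

section Existence

variable {σ : Signature.{u}} {T : RegTheory σ}

/-- Every homomorphism of presented models is represented by a functional relation. -/
theorem ModCat.IsPresentedBy.exists_functionalRel (hT : T.IsCartesian) {Γ Δ : List σ.Sorts}
    {φ : RegFormula σ Γ} {ψ : RegFormula σ Δ} (hφ : φ.IsCartesian T) {a b : ModCat T}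
    {g : a.Tup Γ} {k : b.Tup Δ} (ha : a.IsPresentedBy φ g) (hb : b.IsPresentedBy ψ k)
    (f : b ⟶ a) : ∃ θ : RegFormula σ (Γ ++ Δ), IsFunctionalRel T φ ψ θ ∧
      θ.Realize a.obj (Tuple.append g (ModCat.mapTup f k)) := by
  choose d hd using fun t (i : Var Δ t) => ha.exists_defFun hT hφ (f.hom.toFun t (k i))
  let θ : RegFormula σ (Γ ++ Δ) := (φ.rename (Var.left Δ)).and (.conjVar fun t i =>
    (d t i).formula.rename (Tuple.cons (Var.right Γ i) (Var.left Δ)))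
  have hθ : ∀ (M : Str σ) (x : Tuple M.carrier Γ) (y : Tuple M.carrier Δ),
      θ.Realize M (x.append y) ↔
        φ.Realize M x ∧ ∀ t i, (d t i).formula.Realize M (Tuple.cons (y i) x) := by
    intro M x y
    simp only [θ, RegFormula.realize_and, RegFormula.realize_conjVar,
      RegFormula.realize_rename_cons, Tuple.append_left, Tuple.append_right]
    simp only [RegFormula.realize_rename, Tuple.append_left]
  refine ⟨θ, ⟨⟨hφ.rename _, .conjVar fun t i => (d t i).cartesian.rename _⟩, ?_, ?_, ?_⟩,
    (hθ _ _ _).2 ⟨ha.realize, hd⟩⟩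
  · intro M hM x y h
    rw [hθ] at h
    refine ⟨h.1, ?_⟩
    -- The tuple `x` is induced by some `q`, and the definitions force `y` to be the tuple induced
    -- by `f ≫ q`; it satisfies `ψ` as an image of the generators `k`.
    obtain ⟨q, rfl⟩ := ha.exists_hom (b := ⟨M, hM⟩) h.1
    have : y = ModCat.mapTup (f ≫ q) k := by
      funext t i
      exact (d t i).unique M hM _ _ _ (h.2 t i) (ModCat.realize_cons_map q (hd t i))
    rw [this]
    exact ModCat.realize_mapTup (f ≫ q) hb.realize
  · intro M hM x y y' h h'
    rw [hθ] at h h'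
    funext t i
    exact (d t i).unique M hM _ _ _ (h'.2 t i) (h.2 t i)
  · intro M hM x h
    choose y hy using fun t (i : Var Δ t) => (d t i).total M hM x h
    exact ⟨y, (hθ _ _ _).2 ⟨h, hy⟩⟩

theorem nonempty_hintikkaChoice (M : MorphismProperty (ModCat T))
    (hdef : DefinablePathEmbeddings T M) : Nonempty (HintikkaChoice T M) := by
  have hT := hdef.cartesian
  choose ctx pres gen hcart hpres using fun P : PathObj M =>
    ModCat.exists_isPresentedBy hT P.1 (hdef.path_fp P.1 P.2)
  choose emb hemb using fun P : PathObj M =>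
    hdef.formula P.1 P.2 (pres P) (gen P) (hcart P) (hpres P)
  choose graph hgraph hyon using fun (P P' : PathObj M) (l : P.1 ⟶ P'.1) =>
    (hpres P').exists_functionalRel hT (hcart P') (hpres P) l
  exact ⟨{
    ctx := ctx
    pres := pres
    pres_cartesian := hcart
    gen := gen
    presented := hpres
    emb := emb
    emb_iff := hemb
    graph := fun l _ => graph _ _ l
    graph_functional := fun l _ => hgraph _ _ l
    graph_yoneda := fun l _ => hyon _ _ l
    -- Paths are indexed by the formulae presenting them: these form a small type, and models
    -- presented by the same formula are isomorphic.
    Idx := {q : Σ Γ : List σ.Sorts, RegFormula σ Γ //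
      ∃ (P : PathObj M) (g : P.1.Tup q.1), P.1.IsPresentedBy q.2 g}
    rep := fun q => q.2.choose
    rep_surj := fun P => by
      let q : {q : Σ Γ : List σ.Sorts, RegFormula σ Γ //
          ∃ (P : PathObj M) (g : P.1.Tup q.1), P.1.IsPresentedBy q.2 g} :=
        ⟨⟨ctx P, pres P⟩, P, gen P, hpres P⟩
      exact ⟨q, (hpres P).nonempty_iso q.2.choose_spec.choose_spec⟩ }⟩

end Existence

/-! ## Covers of path embeddings -/

section Covers

variable {C : Type w} [Category.{u} C] {Q M : MorphismProperty C}

namespace IsStableFactorisationSystem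

theorem eq_rlp (hW : IsStableFactorisationSystem Q M) : M = Q.rlp := hW.wfs.rlp.symm

theorem comp_mem (hW : IsStableFactorisationSystem Q M) {x y z : C} {f : x ⟶ y} {g : y ⟶ z} (hf : M f) (hg : M g) : M (f ≫ g) := by
  rw [hW.eq_rlp] at *
  exact MorphismProperty.comp_mem _ _ _ hf hg

theorem of_isIso (hW : IsStableFactorisationSystem Q M) {x y : C} (f : x ⟶ y) [IsIso f] : M f := by
  rw [hW.eq_rlp]
  exact MorphismProperty.rlp_of_isIso _ f

/-- Embeddings are characterised by right lifting against quotients. A lift for `f ≫ g` is also one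
for `f`, the lower triangle being cancelled along the mono `g`. -/
theorem of_comp (hW : IsStableFactorisationSystem Q M) {x y z : C} {f : x ⟶ y} {g : y ⟶ z} (hg : Mono g) (h : M (f ≫ g)) : M f := by
  rw [hW.eq_rlp] at *
  intro A B i hi
  have := h i hi
  refine ⟨fun {u v} sq => ?_⟩
  have sq' : CommSq u i (f ≫ g) (v ≫ g) := ⟨by rw [← Category.assoc, sq.w, Category.assoc]⟩
  exact ⟨⟨sq'.lift, sq'.fac_left, by
    rw [← cancel_mono g, Category.assoc, sq'.fac_right]⟩⟩

end IsStableFactorisationSystem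

namespace PathEmb

variable (hW : IsStableFactorisationSystem Q M) {X : C}

theorem mk_le_mk_iff {P P' : C} {f : P ⟶ X} {g : P' ⟶ X} (hf : M f) (hg : M g)
    (hP : IsPath M P) (hP' : IsPath M P') :
    mk hW f hf hP ≤ mk hW g hg hP' ↔ ∃ h, h ≫ g = f := by
  have := hW.mono f hf
  have := hW.mono g hg
  exact ⟨fun h => ⟨_, Subobject.ofMkLEMk_comp h⟩, fun ⟨h, e⟩ => Subobject.mk_le_mk_of_comm h e⟩

theorem exists_eq_mk (S : PathEmb M X) :
    ∃ (P : C) (f : P ⟶ X) (hf : M f) (hP : IsPath M P), S = mk hW f hf hP :=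
  ⟨_, S.1.arrow, S.2.1, S.2.2, Subtype.ext (Subobject.mk_arrow _).symm⟩

theorem mk_comp_le_mk_comp_iff {P P' Y : C} {f : P ⟶ Y} {g : P' ⟶ Y} {n : Y ⟶ X} (hf : M f)
    (hg : M g) (hn : Mono n) (hfn : M (f ≫ n)) (hgn : M (g ≫ n)) (hP : IsPath M P)
    (hP' : IsPath M P') :
    mk hW (f ≫ n) hfn hP ≤ mk hW (g ≫ n) hgn hP' ↔ mk hW f hf hP ≤ mk hW g hg hP' := by
  simp only [mk_le_mk_iff, ← Category.assoc, cancel_mono]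

/-- Composition with `n` embeds the poset of path embeddings into `P'` in that of `X`, with image
the elements below `n`. A down-set contains every element between two of its members, so covers are
preserved and reflected. -/
theorem mk_comp_covBy_iff {P P' : C} {l : P ⟶ P'} {n : P' ⟶ X} {m : P ⟶ X} (hl : M l)
    (hid : M (𝟙 P')) (hn : M n) (hm : M m) (hlm : l ≫ n = m) (hP : IsPath M P)
    (hP' : IsPath M P') :
    mk hW m hm hP ⋖ mk hW n hn hP' ↔ mk hW l hl hP ⋖ mk hW (𝟙 P') hid hP' := by
  subst hlm
  have hmono := hW.mono n hn
  have hn' : M (𝟙 P' ≫ n) := by rwa [Category.id_comp]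
  have hmk : mk hW n hn hP' = mk hW (𝟙 P' ≫ n) hn' hP' := by simp only [Category.id_comp]
  rw [hmk]
  have hlt : ∀ {D D' : C} {f : D ⟶ P'} {g : D' ⟶ P'} (hf : M f) (hg : M g) (hfn : M (f ≫ n))
      (hgn : M (g ≫ n)) (hD : IsPath M D) (hD' : IsPath M D'),
      mk hW (f ≫ n) hfn hD < mk hW (g ≫ n) hgn hD' ↔ mk hW f hf hD < mk hW g hg hD' := by
    intro D D' f g hf hg hfn hgn hD hD'
    rw [lt_iff_le_not_ge, lt_iff_le_not_ge,
      mk_comp_le_mk_comp_iff hW hf hg hmono hfn hgn, mk_comp_le_mk_comp_iff hW hg hf hmono hgn hfn]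
  refine and_congr (hlt hl hid _ _ _ _) ⟨fun h S h1 h2 => ?_, fun h S h1 h2 => ?_⟩
  · obtain ⟨D, s, hs, hD, rfl⟩ := exists_eq_mk hW S
    exact h ((hlt hl hs hm (hW.comp_mem hs hn) _ _).2 h1)
      ((hlt hs hid (hW.comp_mem hs hn) _ _ _).2 h2)
  · obtain ⟨D, s, hs, hD, rfl⟩ := exists_eq_mk hW S
    -- An intermediate element lies below `n`, hence factors through it; by left cancellation the
    -- factor is an embedding into `P'`.
    obtain ⟨t, rfl⟩ : ∃ t, t ≫ n = s := by
      have := h2.le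
      rw [← hmk] at this
      exact (mk_le_mk_iff hW _ _ _ _).1 this
    have ht := hW.of_comp hmono hs
    exact h ((hlt hl ht _ _ _ _).1 h1) ((hlt ht hid _ _ _ _).1 h2)

end PathEmb

end Covers

/-! ### Recursion equations for the rank -/

section Rank

variable {C : Type w} [Category.{u} C] (M : MorphismProperty C) (a b : C)

theorem posRank_zero : posRank M a b 0 = winning M a b :=
  Ordinal.limitRecOn_zero ..

theorem posRank_add_one (α : Ordinal.{u}) : posRank M a b (α + 1) =
    {p | p ∈ winning M a b ∧
      (∀ m', p.1 ⋖ m' → ∃ n', p.2 ⋖ n' ∧ (m', n') ∈ posRank M a b α) ∧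
      (∀ n', p.2 ⋖ n' → ∃ m', p.1 ⋖ m' ∧ (m', n') ∈ posRank M a b α)} :=
  Ordinal.limitRecOn_add_one ..

theorem posRank_limit {α : Ordinal.{u}} (hα : Order.IsSuccLimit α) :
    posRank M a b α = {p | ∀ β < α, p ∈ posRank M a b β} :=
  Ordinal.limitRecOn_limit _ _ _ _ hα

end Rank

/-! ## Hintikka formulae and the rank of positions -/

namespace HintikkaChoice

variable {σ : Signature.{u}} {T : RegTheory σ} {Q M : MorphismProperty (ModCat T)}

theorem realize_iso_iff {Γ : List σ.Sorts} (P P' : ModCat T) (N : Str σ)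
    (v : Tuple N.carrier Γ) :
    (iso P P' : Formula σ Γ).Realize N v ↔ Nonempty (P ≅ P') := by
  unfold iso
  split_ifs with h
  · exact iff_of_true (Formula.realize_top v) h
  · exact iff_of_false (Formula.not_realize_bot v) h

variable (H : HintikkaChoice T M)

/-- The tuples satisfying the step formula are those that induce an extension of `n` along `l`
to an embedding. -/
theorem realize_stepFormula_iff (hW : IsStableFactorisationSystem Q M) {b : ModCat T}
    {R : PathObj M} (n : R.1 ⟶ b) {i : H.Idx} (l : H.Step hW R i)
    (z : b.Tup (H.ctx (H.rep i))) :
    (H.stepFormula hW R i l).Realize b.obj (z.append (ModCat.mapTup n (H.gen R))) ↔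
      ∃ n' : (H.rep i).1 ⟶ b, M n' ∧ l.1 ≫ n' = n ∧ ModCat.mapTup n' (H.gen (H.rep i)) = z := by
  rw [stepFormula, Formula.realize_and, Formula.realize_and, Formula.realize_rename_left,
    Formula.realize_rename_left]
  have hl := l.2.choose
  -- `ϑ_ℓ` holds at the generators of the representative, and homomorphisms preserve regular
  -- formulae.
  have hgraph : ∀ n' : (H.rep i).1 ⟶ b, (H.graph l.1 hl).Realize b.obj
      (Tuple.append (ModCat.mapTup n' (H.gen (H.rep i)))
        (ModCat.mapTup (l.1 ≫ n') (H.gen R))) := by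
    intro n'
    have := ModCat.realize_mapTup n' (H.graph_yoneda l.1 hl)
    refine cast (congrArg _ ?_) this
    exact Tuple.map_append n'.hom.toFun _ _
  constructor
  · rintro ⟨h1, h2, h3⟩
    obtain ⟨n', rfl⟩ := (H.presented (H.rep i)).exists_hom h1
    refine ⟨n', (H.emb_iff _ _ n' _ rfl).2 h3, (H.presented R).hom_ext ?_, rfl⟩
    -- Over the tuple inducing `n'`, both `n` and `ℓ ≫ n'` give values of the functional relation,
    -- so they agree on the generators of `R`.
    exact (H.graph_functional l.1 hl).unique _ b.property _ _ _ h2 (hgraph n')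
  · rintro ⟨n', hn', rfl, rfl⟩
    exact ⟨ModCat.realize_mapTup n' (H.presented _).realize, hgraph n',
      (H.emb_iff _ _ n' _ rfl).1 hn'⟩

/-- The covers of a path embedding are its extensions along the steps. -/
theorem covBy_iff (hW : IsStableFactorisationSystem Q M) {b : ModCat T} {R : PathObj M}
    (n : R.1 ⟶ b) (hn : M n) (S : PathEmb M b) :
    PathEmb.mk hW n hn R.2 ⋖ S ↔ ∃ (i : H.Idx) (l : H.Step hW R i) (n' : (H.rep i).1 ⟶ b)
      (hn' : M n'), l.1 ≫ n' = n ∧ S = PathEmb.mk hW n' hn' (H.rep i).2 := by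
  constructor
  · intro h
    obtain ⟨D, s, hs, hD, rfl⟩ := PathEmb.exists_eq_mk hW S
    -- Replacing the domain by its chosen representative does not change the subobject, so the small
    -- family of steps reaches every cover.
    obtain ⟨i, ⟨e⟩⟩ := H.rep_surj ⟨D, hD⟩
    have hn' : M (e.inv ≫ s) := hW.comp_mem (hW.of_isIso _) hs
    have hS : PathEmb.mk hW s hs hD = PathEmb.mk hW (e.inv ≫ s) hn' (H.rep i).2 :=
      le_antisymm ((PathEmb.mk_le_mk_iff hW _ _ _ _).2 ⟨e.hom, e.hom_inv_id_assoc s⟩)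
        ((PathEmb.mk_le_mk_iff hW _ _ _ _).2 ⟨e.inv, rfl⟩)
    rw [hS] at h ⊢
    obtain ⟨l, hl⟩ := (PathEmb.mk_le_mk_iff hW _ _ _ _).1 h.le
    have hlM : M l := hW.of_comp (hW.mono _ hn') (by rwa [hl])
    exact ⟨i, ⟨l, hlM, hW.of_isIso _,
      (PathEmb.mk_comp_covBy_iff hW hlM _ hn' hn hl _ _).1 h⟩, _, hn', hl, rfl⟩
  · rintro ⟨i, ⟨l, hlM, hid, hl⟩, n', hn', hln, rfl⟩
    exact (PathEmb.mk_comp_covBy_iff hW hlM hid hn' hn hln _ _).2 hl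

/-- The game sees the domain chosen for the subobject, which is only isomorphic to `R`; the winning
condition is invariant under isomorphism. -/
theorem mem_winning_iff (hW : IsStableFactorisationSystem Q M) {a b : ModCat T}
    (m : PathEmb M a) {R : PathObj M} (n : R.1 ⟶ b) (hn : M n) :
    (m, PathEmb.mk hW n hn R.2) ∈ winning M a b ↔ Nonempty (m.dom ≅ R.1) := by
  have := hW.mono n hn
  let e : (PathEmb.mk hW n hn R.2).dom ≅ R.1 := Subobject.underlyingIso n
  exact ⟨fun ⟨f⟩ => ⟨f ≪≫ e⟩, fun ⟨f⟩ => ⟨f ≪≫ e.symm⟩⟩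

theorem hintikka_zero (hW : IsWooded Q M) (a : ModCat T) (m : PathEmb M a) (P : PathObj M) :
    H.hintikka hW a 0 m P = iso m.dom P.1 := by
  rw [hintikka, Ordinal.limitRecOn_zero]

theorem hintikka_add_one (hW : IsWooded Q M) (a : ModCat T) (α : Ordinal.{u}) (m : PathEmb M a)
    (P : PathObj M) : H.hintikka hW a (α + 1) m P = Formula.and (iso m.dom P.1)
      (Formula.and (H.forth hW a (H.hintikka hW a α) m P)
        (H.back hW a (H.hintikka hW a α) m P)) := by
  rw [hintikka, Ordinal.limitRecOn_add_one]
  rfl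

theorem hintikka_limit (hW : IsWooded Q M) (a : ModCat T) {α : Ordinal.{u}}
    (hα : Order.IsSuccLimit α) (m : PathEmb M a) (P : PathObj M) :
    H.hintikka hW a α m P =
      Formula.bigAnd fun β : Set.Iio α => H.hintikka hW a β.1 m P := by
  rw [hintikka, Ordinal.limitRecOn_limit _ _ _ _ hα]
  rfl

/-- The induction hypothesis must cover all `m`, `R` and `n` at once, since a round replaces `m` and
`n` by covers and `R` by the representative of another path. -/
theorem realize_hintikka_iff (hW : IsWooded Q M) (a b : ModCat T) (α : Ordinal.{u}) :
    ∀ (m : PathEmb M a) (R : PathObj M) (n : R.1 ⟶ b) (hn : M n),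
      (H.hintikka hW a α m R).Realize b.obj (ModCat.mapTup n (H.gen R)) ↔
        (m, PathEmb.mk hW.stable n hn R.2) ∈ posRank M a b α := by
  have := hW.wellPowered
  induction α using Ordinal.limitRecOn with
  | zero =>
    intro m R n hn
    rw [hintikka_zero, posRank_zero, mem_winning_iff, realize_iso_iff]
  | add_one α ih =>
    intro m R n hn
    rw [hintikka_add_one, posRank_add_one, Formula.realize_and, Formula.realize_and, realize_iso_iff]
    refine and_congr (mem_winning_iff hW.stable m n hn).symm (and_congr ?_ ?_)
    · rw [forth, Formula.realize_bigAnd, Subtype.forall]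
      refine forall₂_congr fun m' _ => ?_
      constructor
      · rintro ⟨⟨i, l⟩, h⟩
        obtain ⟨z, hz⟩ := (Formula.realize_exs _ _ _).1 h
        rw [Formula.realize_and, realize_stepFormula_iff, Formula.realize_rename_left] at hz
        obtain ⟨⟨n', hn', hln, rfl⟩, hz⟩ := hz
        exact ⟨_, (H.covBy_iff hW.stable n hn _).2 ⟨i, l, n', hn', hln, rfl⟩,
          (ih m' _ n' hn').1 hz⟩
      · rintro ⟨S, hS, hR⟩
        -- Duplicator's answer is a cover of `n`, hence an extension along some step; the step
        -- selects the disjunct and the tuple of `n'` is the witness for `z'`.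
        obtain ⟨i, l, n', hn', hln, rfl⟩ := (H.covBy_iff hW.stable n hn _).1 hS
        refine ⟨⟨i, l⟩, (Formula.realize_exs _ _ _).2 ⟨_, (Formula.realize_and _ _ _).2
          ⟨(H.realize_stepFormula_iff hW.stable n l _).2 ⟨n', hn', hln, rfl⟩, ?_⟩⟩⟩
        rw [Formula.realize_rename_left]
        exact (ih m' _ n' hn').2 hR
    · constructor
      · intro h S hS
        -- Spoiler's move in `b` selects the conjunct and the instance of `z'`; the disjunct that
        -- then holds names Duplicator's reply.
        obtain ⟨i, l, n', hn', hln, rfl⟩ := (H.covBy_iff hW.stable n hn _).1 hS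
        have := (Formula.realize_alls _ _ _).1 (h ⟨i, l⟩)
          (ModCat.mapTup n' (H.gen (H.rep i)))
        rw [Formula.realize_imp, realize_stepFormula_iff, Formula.realize_bigOr] at this
        obtain ⟨⟨m', hm'⟩, h'⟩ := this ⟨n', hn', hln, rfl⟩
        rw [Formula.realize_rename_left] at h'
        exact ⟨m', hm', (ih m' _ n' hn').1 h'⟩
      · rintro h ⟨i, l⟩
        refine (Formula.realize_alls _ _ _).2 fun z => ?_
        rw [Formula.realize_imp, realize_stepFormula_iff, Formula.realize_bigOr]
        rintro ⟨n', hn', hln, rfl⟩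
        obtain ⟨m', hm', hR⟩ := h _ ((H.covBy_iff hW.stable n hn _).2 ⟨i, l, n', hn', hln, rfl⟩)
        refine ⟨⟨m', hm'⟩, ?_⟩
        rw [Formula.realize_rename_left]
        exact (ih m' _ n' hn').2 hR
  | limit α hα ih =>
    intro m R n hn
    rw [hintikka_limit _ _ _ hα, posRank_limit _ _ _ hα, Formula.realize_bigAnd, Subtype.forall]
    exact forall₂_congr fun β hβ => ih β hβ m R n hn

end HintikkaChoice
theorem mainTheorem3 {σ : Signature.{u}} (T : RegTheory σ) (Q M : MorphismProperty (ModCat T))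
    (hW : IsWooded Q M) (hdef : DefinablePathEmbeddings T M) :
    Nonempty (HintikkaChoice T M) ∧
    ∀ (H : HintikkaChoice T M) (a b : ModCat T)
      (P : ModCat T) (hP : IsPath M P) (m : P ⟶ a) (hm : M m)
      (R : PathObj M) (n : R.1 ⟶ b) (hn : M n)
      (c : b.Tup (H.ctx R)), (H.pres R).Realize b.obj c → ModCat.mapTup n (H.gen R) = c →
      ∀ α : Ordinal.{u},
        (H.hintikka hW a α (PathEmb.mk hW.stable m hm hP) R).Realize b.obj c ↔
          (PathEmb.mk hW.stable m hm hP, PathEmb.mk hW.stable n hn R.2) ∈ posRank M a b α := by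
  refine ⟨nonempty_hintikkaChoice M hdef, ?_⟩
  rintro H a b P hP m hm R n hn c - rfl α
  exact H.realize_hintikka_iff hW a b α _ R n hn
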